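/- Let $d\ge 1$ and let $\Omega\subset\mathbb R^d$ be a bounded open set (for instance a bounded Lipschitz domain, or a ball $B_T=B(\mathbf 0;R+T)$ with $R>0$, $T\ge 0$). All spaces are real. Let $H^1_0(\Omega)$ be the closure of $C_c^\infty(\Omega)$ in $H^1(\Omega)$, let $H^{-1}(\Omega)$ be its dual, with $L^2(\Omega)\subset H^{-1}(\Omega)$ through the $L^2(\Omega)$ inner product $(\cdot,\cdot)_\Omega$, and let $\Delta:H^1_0(\Omega)\to H^{-1}(\Omega)$ be given by $(\Delta u,v)_\Omega=-(\nabla u,\nabla v)_\Omega$ for all $u,v\in H^1_0(\Omega)$. Let $D(\Delta)=\{u\in H^1_0(\Omega):\Delta u\in L^2(\Omega)\}$, with the graph norm (equivalently, the norm $\|\Delta u\|_\Omega$). Let $f:[0,\infty)\to L^2(\Omega)$ be continuous. Then there is a unique weak solution of the Dirichlet problem $$\ddot u(t)=\Delta u(t)+f(t)\quad (t\ge 0),\qquad u(0)=\dot u(0)=0,$$ that is, a unique function $$u\in \mathcal C^2([0,\infty);H^{-1}(\Omega))\cap \mathcal C^1([0,\infty);L^2(\Omega))\cap \mathcal C([0,\infty);H^1_0(\Omega))$$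 such that the equation holds in $H^{-1}(\Omega)$ for every $t\ge 0$ and the initial conditions hold (derivatives at $t=0$ are right derivatives). It satisfies $$\|\nabla u(t)\|_\Omega\le\int_0^t\|f(\tau)\|_\Omega\,\mathrm d\tau\qquad\text{for all } t\ge 0.$$ Moreover, $w(t):=\int_0^t u(\tau)\,\mathrm d\tau$ is a continuous function from $[0,\infty)$ to $D(\Delta)$. If $\Omega=B_T=B(\mathbf 0;R+T)$ with $R>0$ and $T\ge 0$, then $w$ is also continuous from $[0,\infty)$ to $H^2(B_T)$. -/

import Mathlib

open MeasureTheory Set TopologicalSpace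
open scoped Distributions

noncomputable section

namespace DirichletWave

/-- The Euclidean space `ℝ^d`. -/
abbrev Euc (d : ℕ) : Type := EuclideanSpace ℝ (Fin d)

variable {d : ℕ}

/-- The real Hilbert space `L²(Ω)`. -/
abbrev L2 (Ω : Opens (Euc d)) : Type := Lp ℝ 2 (volume.restrict (Ω : Set (Euc d)))

/-- The classical partial derivative `∂_i φ`. -/
def partialDeriv (i : Fin d) (φ : Euc d → ℝ) (x : Euc d) : ℝ :=
  fderiv ℝ φ x (EuclideanSpace.single i 1)

/-- `v = ∂_i u` in the weak sense on `Ω`. Here `𝓓(Ω, ℝ)` is the space of smooth functions with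
compact support contained in `Ω`. -/
def IsWeakDeriv (Ω : Opens (Euc d)) (i : Fin d) (u v : L2 Ω) : Prop :=
  ∀ φ : 𝓓(Ω, ℝ),
    ∫ x in (Ω : Set (Euc d)), u x * partialDeriv i φ x = -∫ x in (Ω : Set (Euc d)), v x * φ x

theorem TestFunction.memLp (Ω : Opens (Euc d)) (φ : 𝓓(Ω, ℝ)) :
    MemLp (φ : Euc d → ℝ) 2 (volume.restrict (Ω : Set (Euc d))) :=
  (φ.contDiff.continuous.memLp_of_hasCompactSupport φ.hasCompactSupport).restrict _

theorem TestFunction.memLp_partialDeriv (Ω : Opens (Euc d)) (φ : 𝓓(Ω, ℝ)) (i : Fin d) :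
    MemLp (partialDeriv i φ) 2 (volume.restrict (Ω : Set (Euc d))) := by
  have h1 : Continuous (partialDeriv i (φ : Euc d → ℝ)) :=
    (φ.contDiff.continuous_fderiv (by simp)).clm_apply continuous_const
  have h2 : HasCompactSupport (partialDeriv i (φ : Euc d → ℝ)) :=
    φ.hasCompactSupport.fderiv_apply (𝕜 := ℝ) _
  exact (h1.memLp_of_hasCompactSupport h2).restrict _

theorem integral_add_mul (Ω : Opens (Euc d)) (u v : L2 Ω) {g : Euc d → ℝ}
    (hg : MemLp g 2 (volume.restrict (Ω : Set (Euc d)))) :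
    ∫ x in (Ω : Set (Euc d)), (u + v : L2 Ω) x * g x =
      (∫ x in (Ω : Set (Euc d)), u x * g x) + ∫ x in (Ω : Set (Euc d)), v x * g x := by
  have hu : Integrable (fun x => u x * g x) (volume.restrict (Ω : Set (Euc d))) :=
    (Lp.memLp u).integrable_mul hg
  have hv : Integrable (fun x => v x * g x) (volume.restrict (Ω : Set (Euc d))) :=
    (Lp.memLp v).integrable_mul hg
  rw [← integral_add hu hv]
  refine integral_congr_ae ?_
  filter_upwards [Lp.coeFn_add u v] with x hx
  rw [hx, Pi.add_apply, add_mul]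

theorem integral_smul_mul (Ω : Opens (Euc d)) (c : ℝ) (u : L2 Ω) (g : Euc d → ℝ) :
    ∫ x in (Ω : Set (Euc d)), (c • u : L2 Ω) x * g x =
      c * ∫ x in (Ω : Set (Euc d)), u x * g x := by
  rw [← integral_const_mul]
  refine integral_congr_ae ?_
  filter_upwards [Lp.coeFn_smul c u] with x hx
  simp [hx, mul_assoc]

theorem integral_zero_mul (Ω : Opens (Euc d)) (g : Euc d → ℝ) :
    ∫ x in (Ω : Set (Euc d)), (0 : L2 Ω) x * g x = 0 := by
  simpa using integral_smul_mul Ω 0 (0 : L2 Ω) g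

theorem IsWeakDeriv.zero (Ω : Opens (Euc d)) (i : Fin d) : IsWeakDeriv Ω i 0 0 := by
  intro φ
  simp only [integral_zero_mul, neg_zero]

theorem IsWeakDeriv.add {Ω : Opens (Euc d)} {i : Fin d} {u u' v v' : L2 Ω}
    (h : IsWeakDeriv Ω i u v) (h' : IsWeakDeriv Ω i u' v') :
    IsWeakDeriv Ω i (u + u') (v + v') := by
  intro φ
  rw [integral_add_mul Ω _ _ (TestFunction.memLp_partialDeriv Ω φ i),
    integral_add_mul Ω _ _ (TestFunction.memLp Ω φ), h φ, h' φ]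
  ring

theorem IsWeakDeriv.smul {Ω : Opens (Euc d)} {i : Fin d} {u v : L2 Ω} (c : ℝ)
    (h : IsWeakDeriv Ω i u v) : IsWeakDeriv Ω i (c • u) (c • v) := by
  intro φ
  rw [integral_smul_mul, integral_smul_mul, h φ]
  ring

/-- The Sobolev space `H¹(Ω)`: a function `u ∈ L²(Ω)` together with its weak gradient
`∇u ∈ L²(Ω)^d` (which is uniquely determined by `u`), with norm
`(‖u‖² + ‖∇u‖²)^{1/2}`, `‖∇u‖² = ∑ i, ‖∂_i u‖²`. -/
def H1 (Ω : Opens (Euc d)) : Submodule ℝ (WithLp 2 (L2 Ω × PiLp 2 (fun _ : Fin d => L2 Ω))) where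
  carrier := {p | ∀ i, IsWeakDeriv Ω i p.fst (p.snd i)}
  zero_mem' i := by simpa using IsWeakDeriv.zero Ω i
  add_mem' {p q} hp hq i := by simpa using (hp i).add (hq i)
  smul_mem' c p hp i := by simpa using (hp i).smul c

/-- The underlying `L²` function of an element of `H¹(Ω)`. -/
def H1.toL2 (Ω : Opens (Euc d)) : H1 Ω →L[ℝ] L2 Ω :=
  (WithLp.fstL 2 ℝ (L2 Ω) (PiLp 2 (fun _ : Fin d => L2 Ω))).comp (H1 Ω).subtypeL

/-- The weak gradient of an element of `H¹(Ω)`. -/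
def H1.grad (Ω : Opens (Euc d)) : H1 Ω →L[ℝ] PiLp 2 (fun _ : Fin d => L2 Ω) :=
  (WithLp.sndL 2 ℝ (L2 Ω) (PiLp 2 (fun _ : Fin d => L2 Ω))).comp (H1 Ω).subtypeL

/-- The test functions `C_c^∞(Ω)`, as a subspace of `H¹(Ω)`. -/
def H1.testFunctions (Ω : Opens (Euc d)) : Submodule ℝ (H1 Ω) where
  carrier := {u | ∃ φ : 𝓓(Ω, ℝ), H1.toL2 Ω u =ᵐ[volume.restrict (Ω : Set (Euc d))] φ}
  zero_mem' := by
    refine ⟨0, ?_⟩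
    rw [map_zero]
    filter_upwards [Lp.coeFn_zero ℝ 2 (volume.restrict (Ω : Set (Euc d)))] with x hx
    rw [hx]
    rfl
  add_mem' := by
    rintro u v ⟨φ, hφ⟩ ⟨ψ, hψ⟩
    refine ⟨φ + ψ, ?_⟩
    rw [map_add]
    filter_upwards [Lp.coeFn_add (H1.toL2 Ω u) (H1.toL2 Ω v), hφ, hψ] with x hx h1 h2
    rw [hx, Pi.add_apply, h1, h2]
    rfl
  smul_mem' := by
    rintro c u ⟨φ, hφ⟩
    refine ⟨c • φ, ?_⟩
    rw [map_smul]
    filter_upwards [Lp.coeFn_smul c (H1.toL2 Ω u), hφ] with x hx h1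
    rw [hx, Pi.smul_apply, h1]
    rfl

/-- `H¹₀(Ω)`: the closure of the test functions in `H¹(Ω)`. -/
def H10 (Ω : Opens (Euc d)) : Submodule ℝ (H1 Ω) := (H1.testFunctions Ω).topologicalClosure

/-- The inclusion of `H¹₀(Ω)` in `L²(Ω)`. -/
def H10.toL2 (Ω : Opens (Euc d)) : H10 Ω →L[ℝ] L2 Ω := (H1.toL2 Ω).comp (H10 Ω).subtypeL

/-- The weak gradient on `H¹₀(Ω)`. -/
def H10.grad (Ω : Opens (Euc d)) : H10 Ω →L[ℝ] PiLp 2 (fun _ : Fin d => L2 Ω) :=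
  (H1.grad Ω).comp (H10 Ω).subtypeL

/-- `H⁻¹(Ω)`, the dual space of `H¹₀(Ω)`. -/
abbrev Hneg1 (Ω : Opens (Euc d)) : Type := StrongDual ℝ (H10 Ω)

/-- The inclusion of `L²(Ω)` in `H⁻¹(Ω)`: `g` acts as `v ↦ (g, v)_Ω`. -/
def L2.toHneg1 (Ω : Opens (Euc d)) (g : L2 Ω) : Hneg1 Ω := (innerSL ℝ g).comp (H10.toL2 Ω)

/-- The Laplace operator `Δ : H¹₀(Ω) → H⁻¹(Ω)`, given by `(Δu, v)_Ω = -(∇u, ∇v)_Ω`. -/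
def laplacian (Ω : Opens (Euc d)) (u : H10 Ω) : Hneg1 Ω :=
  -(innerSL ℝ (H10.grad Ω u)).comp (H10.grad Ω)

theorem L2.toHneg1_apply (Ω : Opens (Euc d)) (g : L2 Ω) (v : H10 Ω) :
    L2.toHneg1 Ω g v = inner ℝ g (H10.toL2 Ω v) := rfl

theorem laplacian_apply (Ω : Opens (Euc d)) (u v : H10 Ω) :
    laplacian Ω u v = -inner ℝ (H10.grad Ω u) (H10.grad Ω v) := rfl

theorem L2.toHneg1_add (Ω : Opens (Euc d)) (g h : L2 Ω) :
    L2.toHneg1 Ω (g + h) = L2.toHneg1 Ω g + L2.toHneg1 Ω h := by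
  apply ContinuousLinearMap.ext
  intro v
  rw [_root_.add_apply]
  simp only [L2.toHneg1_apply]
  exact inner_add_left _ _ _

theorem L2.toHneg1_smul (Ω : Opens (Euc d)) (c : ℝ) (g : L2 Ω) :
    L2.toHneg1 Ω (c • g) = c • L2.toHneg1 Ω g := by
  apply ContinuousLinearMap.ext
  intro v
  rw [_root_.smul_apply]
  simp only [L2.toHneg1_apply]
  exact real_inner_smul_left _ _ _

theorem laplacian_add (Ω : Opens (Euc d)) (u u' : H10 Ω) :
    laplacian Ω (u + u') = laplacian Ω u + laplacian Ω u' := by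
  apply ContinuousLinearMap.ext
  intro v
  rw [_root_.add_apply]
  simp only [laplacian_apply]
  rw [(H10.grad Ω).map_add, inner_add_left, neg_add]

theorem laplacian_smul (Ω : Opens (Euc d)) (c : ℝ) (u : H10 Ω) :
    laplacian Ω (c • u) = c • laplacian Ω u := by
  apply ContinuousLinearMap.ext
  intro v
  rw [_root_.smul_apply]
  simp only [laplacian_apply]
  rw [(H10.grad Ω).map_smul, real_inner_smul_left, smul_eq_mul, mul_neg]

/-- `D(Δ) = {u ∈ H¹₀(Ω) : Δu ∈ L²(Ω)}`. Its elements are the pairs `(u, Δu)`, and its norm is the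
graph norm, which for bounded `Ω` is equivalent to the norm `‖Δu‖` by the Poincaré inequality. -/
def DomLaplacian (Ω : Opens (Euc d)) : Submodule ℝ (WithLp 2 (H10 Ω × L2 Ω)) where
  carrier := {p | laplacian Ω p.fst = L2.toHneg1 Ω p.snd}
  zero_mem' := by
    change laplacian Ω 0 = L2.toHneg1 Ω 0
    rw [← zero_smul ℝ (0 : H10 Ω), laplacian_smul, ← zero_smul ℝ (0 : L2 Ω), L2.toHneg1_smul,
      zero_smul, zero_smul]
  add_mem' {p q} hp hq := by
    change laplacian Ω (p.fst + q.fst) = L2.toHneg1 Ω (p.snd + q.snd)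
    rw [laplacian_add, L2.toHneg1_add, show laplacian Ω p.fst = _ from hp,
      show laplacian Ω q.fst = _ from hq]
  smul_mem' c p hp := by
    change laplacian Ω (c • p.fst) = L2.toHneg1 Ω (c • p.snd)
    rw [laplacian_smul, L2.toHneg1_smul, show laplacian Ω p.fst = _ from hp]

/-- The underlying `L²` function of an element of `D(Δ)`. -/
def DomLaplacian.toL2 (Ω : Opens (Euc d)) (p : DomLaplacian Ω) : L2 Ω := H10.toL2 Ω p.1.fst

/-- The Sobolev space `H²(Ω)`: `u ∈ H¹(Ω)` together with its weak second derivatives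
`∂_j ∂_i u ∈ L²(Ω)`, with norm `(‖u‖² + ‖∇u‖² + ∑ i j, ‖∂_j ∂_i u‖²)^{1/2}`. -/
def H2 (Ω : Opens (Euc d)) :
    Submodule ℝ (WithLp 2 (H1 Ω × PiLp 2 (fun _ : Fin d × Fin d => L2 Ω))) where
  carrier := {p | ∀ i j, IsWeakDeriv Ω j (H1.grad Ω p.fst i) (p.snd (i, j))}
  zero_mem' i j := by simpa using IsWeakDeriv.zero Ω j
  add_mem' {p q} hp hq i j := by simpa using (hp i j).add (hq i j)
  smul_mem' c p hp i j := by simpa using (hp i j).smul c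

/-- The underlying `L²` function of an element of `H²(Ω)`. -/
def H2.toL2 (Ω : Opens (Euc d)) (p : H2 Ω) : L2 Ω := H1.toL2 Ω p.1.fst

/-- `u` is a weak solution on `[0, ∞)` of `ü = Δu + f` in `Ω` with homogeneous Dirichlet boundary
condition and `u(0) = u̇(0) = 0`: it belongs to
`C²([0,∞); H⁻¹(Ω)) ∩ C¹([0,∞); L²(Ω)) ∩ C([0,∞); H¹₀(Ω))`, and the wave equation holds in `H⁻¹(Ω)`
for every `t ≥ 0`. Derivatives at `t = 0` are right derivatives; only the values of `u` and `f` on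
`[0, ∞)` matter. -/
structure IsWeakSolution (Ω : Opens (Euc d)) (f : ℝ → L2 Ω) (u : ℝ → H10 Ω) : Prop where
  contDiffOn_Hneg1 : ContDiffOn ℝ 2 (fun t => L2.toHneg1 Ω (H10.toL2 Ω (u t))) (Ici 0)
  contDiffOn_L2 : ContDiffOn ℝ 1 (fun t => H10.toL2 Ω (u t)) (Ici 0)
  continuousOn_H10 : ContinuousOn u (Ici 0)
  wave_eq : ∀ t : ℝ, 0 ≤ t →
    iteratedDerivWithin 2 (fun s => L2.toHneg1 Ω (H10.toL2 Ω (u s))) (Ici 0) t =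
      laplacian Ω (u t) + L2.toHneg1 Ω (f t)
  initial_value : u 0 = 0
  initial_velocity : derivWithin (fun t => H10.toL2 Ω (u t)) (Ici 0) 0 = 0

end DirichletWave

end

/-!
The wave equation is solved on the energy space `W × H`, where `W` is `H¹₀(Ω)` with the inner
product `(∇u, ∇v)` (equivalent to the given one by the Poincaré inequality) and `H = L²(Ω)`. The
generator `(u, v) ↦ (v, Δu)` is unbounded, but its inverse `R (u, v) = (-j* v, j u)`, with the
inclusion `j` of `W` in `H`, is a bounded, injective operator that is skew: `(R x, x) = 0`
(`inner_waveInverse_self`). So `U' = R⁻¹ U + F` is read as `R U(t) = ∫₀ᵗ U + R ∫₀ᵗ F`. The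
resolvents `(R - ε)⁻¹` are bounded and dissipative, the equations with these in place of `R⁻¹` are
solved by exponentials, and the solutions converge, uniformly on bounded intervals, as `ε → 0`
(`exists_mild_solution`). The energy estimate for dissipative operators passes to the limit and
gives the bound on the gradient. Uniqueness holds because `Y(t) = ∫₀ᵗ U` satisfies `Y = R Y'`, so
that `‖Y‖²` has derivative `2 (Y, Y') = 0` (`eq_zero_of_skew_integral`). The first component of the
integrated equation reads `Δ ∫₀ᵗ u = u̇(t) - ∫₀ᵗ f`, which is continuous in `L²`; hence the
primitive of `u` is continuous in `D(Δ)`. `IsDualWaveSolution` and `exists_dualWaveSolution`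
translate between the integrated system and weak solutions in the sense of `IsWeakSolution`.

On a ball of radius `ρ`, with `η = ρ² - |x|²`, the embedding of `D(Δ)` in `H²` comes from explicit
solutions `u = η q`, where `q` is a polynomial. Such `u` belong to `H¹₀` (`polyH1_mem_H10`), and
every polynomial is of the form `Δ(η q)`: the map `q ↦ Δ(η q)` is injective on the
finite-dimensional space of polynomials of degree at most `m`, hence surjective
(`exists_polyLap_eq`). For them, `|D²u|² - (Δu)²` is the divergence of `(D²u) ∇u - (Δu) ∇u`, whose
outward flux through the sphere is nonpositive by convexity, so that `‖D²u‖ ≤ ‖Δu‖`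
(`integral_hessian_le`). Polynomials are dense in `L²` (`denseRange_polyL2`), so `Δu ↦ D²u` extends
to a bounded operator on `L²`, whose values are the weak second derivatives of the solution of the
Dirichlet problem (`isWeakDeriv_hessianMap`).
-/

noncomputable section

namespace DirichletWave

open Filter Topology ContDiff

/-! ### Evolution equations with the inverse of a skew operator -/

section SkewEvolution

variable {X : Type*} [NormedAddCommGroup X] [InnerProductSpace ℝ X] {R : X →L[ℝ] X}

theorem inner_apply_eq_neg_of_skew (hR : ∀ x, inner ℝ (R x) x = 0) (x y : X) :
    inner ℝ (R x) y = -inner ℝ x (R y) := by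
  have h := hR (x + y)
  simp only [map_add, inner_add_left, inner_add_right, hR] at h
  rw [real_inner_comm (R y) x]
  linarith

variable [CompleteSpace X]

theorem hasDerivAt_exp_smul_apply (B : X →L[ℝ] X) {y : ℝ → X} {y' : X} {t : ℝ}
    (hy : HasDerivAt y y' t) :
    HasDerivAt (fun s => NormedSpace.exp (s • B) (y s))
      (B (NormedSpace.exp (t • B) (y t)) + NormedSpace.exp (t • B) y') t :=
  (hasDerivAt_exp_smul_const' (𝕂 := ℝ) B t).clm_apply hy

theorem continuous_exp_smul (B : X →L[ℝ] X) :
    Continuous (fun s : ℝ => NormedSpace.exp (s • B)) :=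
  continuous_iff_continuousAt.2 fun t => (hasDerivAt_exp_smul_const (𝕂 := ℝ) B t).continuousAt

theorem exp_smul_neg_apply (B : X →L[ℝ] X) (t : ℝ) (x : X) :
    NormedSpace.exp (t • B) (NormedSpace.exp ((-t) • B) x) = x := by
  let _ : NormedAlgebra ℚ (X →L[ℝ] X) := NormedAlgebra.restrictScalars ℚ ℝ (X →L[ℝ] X)
  have h := NormedSpace.exp_add_of_commute (𝔸 := X →L[ℝ] X)
    (((Commute.refl B).smul_left t).smul_right (-t))
  rw [← add_smul, add_neg_cancel, zero_smul, NormedSpace.exp_zero] at h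
  simpa using (congrArg (fun A : X →L[ℝ] X => A x) h).symm

/-- The exponential of a dissipative operator is a contraction semigroup. -/
theorem norm_exp_smul_apply_le {B : X →L[ℝ] X} (hB : ∀ x, inner ℝ (B x) x ≤ 0)
    {t : ℝ} (ht : 0 ≤ t) (x : X) : ‖NormedSpace.exp (t • B) x‖ ≤ ‖x‖ := by
  have hd : ∀ s : ℝ, HasDerivAt (fun s => NormedSpace.exp (s • B) x)
      (B (NormedSpace.exp (s • B) x)) s := fun s => by
    simpa using hasDerivAt_exp_smul_apply B (hasDerivAt_const s x)
  have hn : ∀ s : ℝ, HasDerivAt (fun s => ‖NormedSpace.exp (s • B) x‖ ^ 2)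
      (2 * inner ℝ (NormedSpace.exp (s • B) x) (B (NormedSpace.exp (s • B) x))) s :=
    fun s => (hd s).norm_sq
  have hanti : Antitone (fun s : ℝ => ‖NormedSpace.exp (s • B) x‖ ^ 2) :=
    antitone_of_deriv_nonpos (fun s => (hn s).differentiableAt) fun s => by
      rw [(hn s).deriv, real_inner_comm]
      linarith [hB (NormedSpace.exp (s • B) x)]
  have h := hanti ht
  simp only [zero_smul, NormedSpace.exp_zero, one_apply_eq_self] at h
  exact le_of_sq_le_sq h (norm_nonneg _)

/-- Variation of constants. -/
theorem exists_hasDerivAt_eq_apply_add (B : X →L[ℝ] X) {F : ℝ → X} (hF : Continuous F) :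
    ∃ U : ℝ → X, U 0 = 0 ∧ ∀ t, HasDerivAt U (B (U t) + F t) t := by
  have hc : Continuous fun s : ℝ => NormedSpace.exp ((-s) • B) (F s) :=
    ((continuous_exp_smul B).comp continuous_neg).clm_apply hF
  refine ⟨fun t => NormedSpace.exp (t • B) (∫ s in (0 : ℝ)..t, NormedSpace.exp ((-s) • B) (F s)),
    by simp, fun t => ?_⟩
  have h := hasDerivAt_exp_smul_apply B (hc.integral_hasStrictDerivAt 0 t).hasDerivAt
  rwa [exp_smul_neg_apply] at h

/-- The energy estimate for an inhomogeneous linear equation with a dissipative operator. -/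
theorem norm_le_integral_of_hasDerivAt {B : X →L[ℝ] X} (hB : ∀ x, inner ℝ (B x) x ≤ 0)
    {g : ℝ → X} (hg : Continuous g) {y : ℝ → X} (h0 : y 0 = 0)
    (hy : ∀ t, HasDerivAt y (B (y t) + g t) t) {t : ℝ} (ht : 0 ≤ t) :
    ‖y t‖ ≤ ∫ s in (0 : ℝ)..t, ‖g s‖ := by
  have hexp : Continuous fun s : ℝ => NormedSpace.exp ((t - s) • B) (g s) :=
    ((continuous_exp_smul B).comp (continuous_const.sub continuous_id)).clm_apply hg
  have hz : ∀ s : ℝ, HasDerivAt (fun s => NormedSpace.exp ((t - s) • B) (y s))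
      (NormedSpace.exp ((t - s) • B) (g s)) s := by
    intro s
    have h1 : HasDerivAt (fun s : ℝ => NormedSpace.exp ((t - s) • B))
        (-(NormedSpace.exp ((t - s) • B) * B)) s := by
      have := (hasDerivAt_exp_smul_const (𝕂 := ℝ) B (t - s)).scomp s
        ((hasDerivAt_id s).const_sub t)
      rwa [neg_one_smul] at this
    have h2 := h1.clm_apply (hy s)
    convert h2 using 1
    simp
  have hint := intervalIntegral.integral_eq_sub_of_hasDerivAt (fun s _ => hz s)
    (hexp.intervalIntegrable 0 t)
  simp only [sub_self, zero_smul, NormedSpace.exp_zero, one_apply_eq_self, h0,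
    map_zero, sub_zero] at hint
  rw [← hint]
  refine (intervalIntegral.norm_integral_le_integral_norm ht).trans ?_
  refine intervalIntegral.integral_mono_on ht (hexp.norm.intervalIntegrable 0 t)
    (hg.norm.intervalIntegrable 0 t) fun s hs => ?_
  exact norm_exp_smul_apply_le hB (sub_nonneg.2 hs.2) _

theorem denseRange_of_skew (hR : ∀ x, inner ℝ (R x) x = 0) (hinj : Function.Injective R) :
    DenseRange R := by
  have h : (LinearMap.range (R : X →ₗ[ℝ] X)).topologicalClosure = ⊤ := by
    rw [Submodule.topologicalClosure_eq_top_iff, Submodule.eq_bot_iff]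
    intro x hx
    have : R x = 0 := by
      rw [← inner_self_eq_zero (𝕜 := ℝ)]
      have := hx (R (R x)) ⟨R x, rfl⟩
      rw [inner_apply_eq_neg_of_skew hR] at this
      linarith
    exact hinj (by simpa using this)
  have h2 := (Submodule.dense_iff_topologicalClosure_eq_top).2 h
  exact h2

/-- The resolvent `(R - ε)⁻¹` of a skew operator, for `ε > 0`: a bounded dissipative operator,
which for small `ε` stands in for the unbounded operator `R⁻¹`. -/
theorem exists_resolvent_of_skew (hR : ∀ x, inner ℝ (R x) x = 0) {ε : ℝ} (hε : 0 < ε) :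
    ∃ B : X →L[ℝ] X, (∀ x, R (B x) = x + ε • B x) ∧ (∀ x, B (R x) = x + ε • B x) ∧
      (∀ x, inner ℝ (B x) x ≤ 0) ∧ ∀ x, ‖ε • B x‖ ≤ ‖x‖ := by
  let b : X →L[ℝ] X →L[ℝ] ℝ := (innerSL ℝ).comp (ε • ContinuousLinearMap.id ℝ X - R)
  have hb : ∀ v w, b v w = inner ℝ (ε • v - R v) w := fun v w => rfl
  have hco : IsCoercive b := ⟨ε, hε, fun v => by
    rw [hb, inner_sub_left, hR, real_inner_smul_left, real_inner_self_eq_norm_sq]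
    apply le_of_eq; ring⟩
  let e := hco.continuousLinearEquivOfBilin
  have he : ∀ v, e v = ε • v - R v := fun v => by
    refine ext_inner_right ℝ fun w => ?_
    rw [hco.continuousLinearEquivOfBilin_apply, hb]
  let B : X →L[ℝ] X := -(e.symm : X →L[ℝ] X)
  have h1 : ∀ x, R (B x) = x + ε • B x := fun x => by
    have := he (B x)
    have h' : e (B x) = -x := by simp [B]
    rw [h', eq_sub_iff_add_eq] at this
    rw [← this]; abel
  have hinj : ∀ x, R x - ε • x = 0 → x = 0 := fun x hx => by
    have : e x = 0 := by rw [he, ← neg_sub, hx, neg_zero]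
    simpa using this
  have hdis : ∀ x, inner ℝ (B x) x = -(ε * ‖B x‖ ^ 2) := fun x => by
    have hx : x = R (B x) - ε • B x := by rw [h1]; abel
    have h0 : inner ℝ (B x) x = inner ℝ (B x) (R (B x) - ε • B x) := by rw [← hx]
    rw [h0, inner_sub_right, real_inner_comm, hR, real_inner_smul_right,
      real_inner_self_eq_norm_sq]
    ring
  refine ⟨B, h1, fun x => ?_, fun x => ?_, fun x => ?_⟩
  · have h2 := hinj (B (R x) - (x + ε • B x)) (by
      simp only [map_sub, map_add, map_smul, h1]
      module)
    exact sub_eq_zero.1 h2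
  · rw [hdis]
    have := mul_nonneg hε.le (sq_nonneg ‖B x‖)
    linarith
  · rw [norm_smul, Real.norm_of_nonneg hε.le]
    by_cases hx : ‖B x‖ = 0
    · rw [hx, mul_zero]; exact norm_nonneg _
    · have hpos : 0 < ‖B x‖ := lt_of_le_of_ne (norm_nonneg _) (Ne.symm hx)
      have h3 := (abs_le.1 (abs_real_inner_le_norm (B x) x)).1
      rw [hdis] at h3
      refine le_of_mul_le_mul_left ?_ hpos
      nlinarith

/-- Uniqueness for the evolution `R U' = U`, in its integrated form. -/
theorem eq_zero_of_skew_integral (hR : ∀ x, inner ℝ (R x) x = 0) (hinj : Function.Injective R)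
    {U : ℝ → X} (hU : ContinuousOn U (Ici 0))
    (h : ∀ t, 0 ≤ t → R (U t) = ∫ s in (0 : ℝ)..t, U s) {t : ℝ} (ht : 0 ≤ t) : U t = 0 := by
  let V : ℝ → X := fun t => U (max t 0)
  have hV : Continuous V := hU.comp_continuous (by fun_prop) fun t => le_max_right t 0
  have hVU : ∀ s, 0 ≤ s → V s = U s := fun s hs => by simp [V, max_eq_left hs]
  let W : ℝ → X := fun t => ∫ s in (0 : ℝ)..t, V s
  have hW : ∀ t, 0 ≤ t → W t = R (V t) := fun t ht => by
    rw [hVU t ht, h t ht]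
    refine intervalIntegral.integral_congr fun s hs => ?_
    rw [uIcc_of_le ht] at hs
    exact hVU s hs.1
  have hd : ∀ t, HasDerivAt W (V t) t := fun t => (hV.integral_hasStrictDerivAt 0 t).hasDerivAt
  have hWc : Continuous W := continuous_iff_continuousAt.2 fun t => (hd t).continuousAt
  have hconst : ∀ x ∈ Icc (0 : ℝ) t, ‖W x‖ ^ 2 = ‖W 0‖ ^ 2 := by
    refine constant_of_has_deriv_right_zero (hWc.norm.pow 2).continuousOn fun x hx => ?_
    have h1 := (hd x).norm_sq.hasDerivWithinAt (s := Ici x)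
    rwa [hW x hx.1, hR, mul_zero] at h1
  have h2 := hconst t ⟨ht, le_rfl⟩
  have h3 : W 0 = 0 := by simp [W]
  rw [h3, hW t ht, norm_zero] at h2
  have h4 : R (V t) = 0 := by simpa using h2
  rw [← hVU t ht]
  exact hinj (by simpa using h4)

end SkewEvolution

section MildSolution

variable {X : Type*} [NormedAddCommGroup X] [InnerProductSpace ℝ X]

/-- A dense-range argument: uniformly bounded operators that converge to zero on the range of `R`
converge to zero pointwise. -/
theorem tendsto_zero_of_denseRange {R : X →L[ℝ] X} (hdense : DenseRange R) {ε : ℕ → ℝ}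
    (hε : Tendsto ε atTop (𝓝 0)) {S : ℕ → X →L[ℝ] X} (hS : ∀ n x, ‖S n x‖ ≤ ‖x‖)
    (hSR : ∀ n x, ‖S n (R x)‖ ≤ 2 * ε n * ‖x‖) (x : X) :
    Tendsto (fun n => S n x) atTop (𝓝 0) := by
  rw [Metric.tendsto_atTop]
  intro e he
  obtain ⟨y, hy⟩ := hdense.exists_dist_lt x (half_pos he)
  have h1 : Tendsto (fun n => 2 * ε n * ‖y‖) atTop (𝓝 0) := by
    simpa using (hε.const_mul 2).mul_const ‖y‖
  obtain ⟨N, hN⟩ := eventually_atTop.1 (h1.eventually_lt_const (half_pos he))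
  refine ⟨N, fun n hn => ?_⟩
  have h2 : S n x = S n (x - R y) + S n (R y) := by rw [← map_add]; simp
  rw [dist_zero_right, h2]
  have h3 := hS n (x - R y)
  rw [← dist_eq_norm] at h3
  linarith [norm_add_le (S n (x - R y)) (S n (R y)), hSR n y, hN n hn]

variable [CompleteSpace X]

/-- If `R` is skew and injective, the equation `R U' = U + R F`, `U(0) = 0`, has a continuous
solution in integrated form, and it obeys the energy estimate. The solution is the limit of the
solutions of `U' = Bₙ U + F` with the resolvents `Bₙ = (R - εₙ)⁻¹`. They form a Cauchy sequence
when `F` takes values in the range of `R²`, since `Bₙ R²` is a Cauchy sequence in the operator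
norm, and `(R Bₙ)² F → F` allows to reduce the general case to this one. -/
theorem exists_mild_solution {R : X →L[ℝ] X} (hR : ∀ x, inner ℝ (R x) x = 0)
    (hinj : Function.Injective R) {F : ℝ → X} (hF : Continuous F) :
    ∃ U : ℝ → X, ContinuousOn U (Ici 0) ∧
      (∀ t, 0 ≤ t → R (U t) = (∫ s in (0 : ℝ)..t, U s) + R (∫ s in (0 : ℝ)..t, F s)) ∧
      ∀ t, 0 ≤ t → ‖U t‖ ≤ ∫ s in (0 : ℝ)..t, ‖F s‖ := by
  obtain ⟨ε, -, hpos, hε⟩ := exists_seq_strictAnti_tendsto (0 : ℝ)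
  choose B hRB hBR hdis hcon using fun n => exists_resolvent_of_skew hR (hpos n)
  have hdense := denseRange_of_skew hR hinj
  -- `ε Bₙ → 0` strongly
  have hB0 : ∀ x, Tendsto (fun n => ε n • B n x) atTop (𝓝 0) := fun x => by
    refine tendsto_zero_of_denseRange hdense hε (S := fun n => ε n • B n) (fun n x => hcon n x)
      (fun n x => ?_) x
    rw [_root_.smul_apply, hBR, norm_smul, Real.norm_of_nonneg (hpos n).le]
    have := mul_le_mul_of_nonneg_left ((norm_add_le x (ε n • B n x)).trans
      (add_le_add_right (hcon n x) _)) (hpos n).le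
    linarith
  have hRBle : ∀ n x, ‖R (B n x)‖ ≤ 2 * ‖x‖ := fun n x => by
    rw [hRB]; linarith [norm_add_le x (ε n • B n x), hcon n x]
  have hRBlim : ∀ x, Tendsto (fun n => R (B n x)) atTop (𝓝 x) := fun x => by
    simpa [hRB] using (hB0 x).const_add x
  have hcomm : ∀ n x, R (B n x) = B n (R x) := fun n x => by rw [hRB, hBR]
  choose U hU0 hU using fun n => fun (G : {G : ℝ → X // Continuous G}) =>
    exists_hasDerivAt_eq_apply_add (B n) G.2
  have hUc : ∀ n G, Continuous (U n G) := fun n G =>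
    continuous_iff_continuousAt.2 fun t => (hU n G t).continuousAt
  have hUle : ∀ n (G : {G : ℝ → X // Continuous G}) t, 0 ≤ t →
      ‖U n G t‖ ≤ ∫ s in (0 : ℝ)..t, ‖G.1 s‖ := fun n G t ht =>
    norm_le_integral_of_hasDerivAt (hdis n) G.2 (hU0 n G) (hU n G) ht
  have hmono : ∀ (G : ℝ → X), Continuous G → ∀ s t : ℝ, 0 ≤ s → s ≤ t →
      ∫ r in (0 : ℝ)..s, ‖G r‖ ≤ ∫ r in (0 : ℝ)..t, ‖G r‖ := fun G hG s t hs hst =>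
    intervalIntegral.integral_mono_interval le_rfl hs hst
      (Eventually.of_forall fun _ => norm_nonneg _)
      (hG.norm.intervalIntegrable _ _)
  -- the difference of two regularised solutions with data `R² L`
  have hreg : ∀ (L : {G : ℝ → X // Continuous G}) (T : ℝ), ∀ m n t, 0 ≤ t → t ≤ T →
      ‖R (R (U m L t)) - R (R (U n L t))‖ ≤
        T * ((2 * ε m + 2 * ε n) * ∫ s in (0 : ℝ)..T, ‖L.1 s‖) := by
    intro L T m n t ht htT
    have hBB : ∀ x, ‖B m (R (R x)) - B n (R (R x))‖ ≤ (2 * ε m + 2 * ε n) * ‖x‖ := fun x => by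
      have h1 : B m (R (R x)) - B n (R (R x)) =
          ε m • (x + ε m • B m x) - ε n • (x + ε n • B n x) := by
        rw [hBR, hBR, hBR, hBR]; abel
      have h2 : ∀ k, ‖ε k • (x + ε k • B k x)‖ ≤ 2 * ε k * ‖x‖ := fun k => by
        rw [norm_smul, Real.norm_of_nonneg (hpos k).le]
        have := mul_le_mul_of_nonneg_left ((norm_add_le x (ε k • B k x)).trans
          (add_le_add_right (hcon k x) _)) (hpos k).le
        linarith
      rw [h1, add_mul]
      exact (norm_sub_le _ _).trans (add_le_add (h2 m) (h2 n))
    have hRR : ∀ k s, HasDerivAt (fun t => R (R (U k L t)))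
        (B k (R (R (U k L s))) + R (R (L.1 s))) s := fun k s => by
      have := R.hasFDerivAt.comp_hasDerivAt s (R.hasFDerivAt.comp_hasDerivAt s (hU k L s))
      simp only [map_add, hcomm] at this
      exact this
    have hg : Continuous fun s => B m (R (R (U n L s))) - B n (R (R (U n L s))) := by
      have := hUc n L
      fun_prop
    have h3 := norm_le_integral_of_hasDerivAt (hdis m) hg
      (y := fun t => R (R (U m L t)) - R (R (U n L t))) (by simp [hU0]) (fun s => by
        refine ((hRR m s).fun_sub (hRR n s)).congr_deriv ?_
        rw [map_sub]; abel) ht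
    refine h3.trans ((intervalIntegral.integral_mono_on ht (hg.norm.intervalIntegrable _ _)
      (intervalIntegrable_const (c := (2 * ε m + 2 * ε n) * ∫ s in (0 : ℝ)..T, ‖L.1 s‖))
      fun s hs => (hBB _).trans ?_).trans ?_)
    · refine mul_le_mul_of_nonneg_left ((hUle n L s hs.1).trans
        (hmono _ L.2 s T hs.1 (hs.2.trans htT))) ?_
      linarith [hpos m, hpos n]
    · rw [intervalIntegral.integral_const, smul_eq_mul, sub_zero]
      refine mul_le_mul_of_nonneg_right htT (mul_nonneg (by linarith [hpos m, hpos n]) ?_)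
      exact intervalIntegral.integral_nonneg (ht.trans htT) fun _ _ => norm_nonneg _
  -- approximation of `F` by data in the range of `R²`
  have happrox : ∀ T, 0 ≤ T → ∀ e > 0, ∃ L : {G : ℝ → X // Continuous G},
      ∫ s in (0 : ℝ)..T, ‖F s - R (R (L.1 s))‖ < e := by
    intro T hT e he
    have hlim : Tendsto (fun n => ∫ s in (0 : ℝ)..T, ‖F s - R (R (B n (B n (F s))))‖) atTop
        (𝓝 (∫ s in (0 : ℝ)..T, (0 : ℝ))) := by
      refine intervalIntegral.tendsto_integral_filter_of_dominated_convergence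
        (fun s => 5 * ‖F s‖) (Eventually.of_forall fun n => ?_) (Eventually.of_forall fun n =>
          ae_of_all _ fun s _ => ?_) ((hF.norm.const_mul 5).intervalIntegrable _ _)
          (ae_of_all _ fun s _ => ?_)
      · exact (by fun_prop :
          Continuous fun s => ‖F s - R (R (B n (B n (F s))))‖).aestronglyMeasurable
      · rw [norm_norm, hcomm n (B n (F s))]
        have h1 := hRBle n (R (B n (F s)))
        rw [hcomm n (R _)] at h1
        linarith [norm_sub_le (F s) (R (B n (R (B n (F s))))), hRBle n (R (B n (F s))),
          hRBle n (F s)]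
      · have h1 : ∀ n, R (R (B n (B n (F s)))) = F s + ε n • B n (F s) +
            ε n • B n (R (B n (F s))) := fun n => by
          rw [hcomm n (B n (F s)), hRB n (R (B n (F s))), hRB]
        have h2 : Tendsto (fun n => ε n • B n (R (B n (F s)))) atTop (𝓝 0) := by
          have h3 : ∀ n, ε n • B n (R (B n (F s))) =
              ε n • B n (F s) + ε n • B n (R (B n (F s)) - F s) := fun n => by
            rw [map_sub, smul_sub]; abel
          simp only [h3]
          have h4 : Tendsto (fun n => ε n • B n (R (B n (F s)) - F s)) atTop (𝓝 0) := by
            refine squeeze_zero_norm (fun n => hcon n _) ?_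
            simpa using ((hRBlim (F s)).sub_const (F s)).norm
          simpa using (hB0 (F s)).add h4
        simp only [h1]
        have h5 := (((hB0 (F s)).const_add (F s)).add h2).const_sub (F s)
        simpa using h5.norm
    rw [intervalIntegral.integral_zero] at hlim
    obtain ⟨n, hn⟩ := (hlim.eventually_lt_const he).exists
    exact ⟨⟨fun s => B n (B n (F s)), by fun_prop⟩, hn⟩
  let V : ℕ → ℝ → X := fun n => U n ⟨F, hF⟩
  have hVc : ∀ n, Continuous (V n) := fun n => hUc n _
  have hVle : ∀ n t, 0 ≤ t → ‖V n t‖ ≤ ∫ s in (0 : ℝ)..t, ‖F s‖ := fun n => hUle n ⟨F, hF⟩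
  have hcauchy : ∀ T, 0 ≤ T → ∀ e > 0, ∃ N, ∀ m ≥ N, ∀ n ≥ N, ∀ t ∈ Icc (0 : ℝ) T,
      dist (V m t) (V n t) < e := by
    intro T hT e he
    obtain ⟨L, hL⟩ := happrox T hT (e / 4) (by positivity)
    let M := T * (4 * ∫ s in (0 : ℝ)..T, ‖L.1 s‖)
    have hlim : Tendsto (fun n => ε n * M) atTop (𝓝 0) := by simpa using hε.mul_const M
    obtain ⟨N, hN⟩ := eventually_atTop.1 (hlim.eventually_lt_const (show 0 < e / 4 by positivity))
    have hdiff : ∀ n, ∀ t ∈ Icc (0 : ℝ) T, ‖V n t - R (R (U n L t))‖ < e / 4 := by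
      intro n t ht
      have hg : Continuous fun s => F s - R (R (L.1 s)) := by
        have := L.2
        fun_prop
      refine lt_of_le_of_lt ((norm_le_integral_of_hasDerivAt (hdis n) hg
        (y := fun t => V n t - R (R (U n L t))) (by simp [hU0, V]) (fun s => ?_) ht.1).trans
        (hmono _ hg t T ht.1 ht.2)) hL
      have h1 := R.hasFDerivAt.comp_hasDerivAt s (R.hasFDerivAt.comp_hasDerivAt s (hU n L s))
      simp only [map_add, hcomm] at h1
      refine ((hU n ⟨F, hF⟩ s).fun_sub h1).congr_deriv ?_
      rw [map_sub]
      abel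
    refine ⟨N, fun m hm n hn t ht => ?_⟩
    have h1 := hreg L T m n t ht.1 ht.2
    have h2 : T * ((2 * ε m + 2 * ε n) * ∫ s in (0 : ℝ)..T, ‖L.1 s‖) =
        (ε m * M + ε n * M) / 2 := by
      simp only [M]; ring
    rw [dist_eq_norm]
    have h3 : V m t - V n t = (V m t - R (R (U m L t))) - (V n t - R (R (U n L t))) +
        (R (R (U m L t)) - R (R (U n L t))) := by abel
    rw [h3]
    have h4 := norm_add_le ((V m t - R (R (U m L t))) - (V n t - R (R (U n L t))))
      (R (R (U m L t)) - R (R (U n L t)))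
    have h5 := norm_sub_le (V m t - R (R (U m L t))) (V n t - R (R (U n L t)))
    linarith [hdiff m t ht, hdiff n t ht, hN m hm, hN n hn]
  have hex : ∀ t : ℝ, ∃ x, 0 ≤ t → Tendsto (fun n => V n t) atTop (𝓝 x) := by
    intro t
    by_cases ht : 0 ≤ t
    · have : CauchySeq fun n => V n t := Metric.cauchySeq_iff.2 fun e he => by
        obtain ⟨N, hN⟩ := hcauchy t ht e he
        exact ⟨N, fun m hm n hn => hN m hm n hn t ⟨ht, le_rfl⟩⟩
      obtain ⟨x, hx⟩ := cauchySeq_tendsto_of_complete this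
      exact ⟨x, fun _ => hx⟩
    · exact ⟨0, fun h => absurd h ht⟩
  choose W hW using hex
  have hWcT : ∀ T, 0 ≤ T → ContinuousOn W (Icc 0 T) := fun T hT => by
    have h1 : UniformCauchySeqOn V atTop (Icc 0 T) := Metric.uniformCauchySeqOn_iff.2 (hcauchy T hT)
    exact (h1.tendstoUniformlyOn_of_tendsto fun t ht => hW t ht.1).continuousOn
      (Eventually.of_forall fun n => (hVc n).continuousOn).frequently
  have hWc : ContinuousOn W (Ici 0) := fun t ht => by
    have h1 := hWcT (t + 1) (by linarith [mem_Ici.1 ht]) t ⟨ht, by linarith⟩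
    refine h1.mono_of_mem_nhdsWithin ?_
    rw [← Ici_inter_Iic]
    exact inter_mem_nhdsWithin _ (Iic_mem_nhds (by linarith))
  refine ⟨W, hWc, fun t ht => ?_, fun t ht => ?_⟩
  · have hid : ∀ n, R (V n t) = (∫ s in (0 : ℝ)..t, R (B n (V n s))) +
        R (∫ s in (0 : ℝ)..t, F s) := fun n => by
      have hc1 : Continuous fun s => B n (V n s) := (B n).continuous.comp (hVc n)
      have h1 := intervalIntegral.integral_eq_sub_of_hasDerivAt
        (fun s _ => hU n ⟨F, hF⟩ s) ((hc1.add hF).intervalIntegrable 0 t)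
      rw [hU0, sub_zero, intervalIntegral.integral_add (hc1.intervalIntegrable 0 t)
        (hF.intervalIntegrable 0 t)] at h1
      rw [R.intervalIntegral_comp_comm (hc1.intervalIntegrable 0 t), ← map_add]
      exact congrArg R h1.symm
    have hlim : Tendsto (fun n => ∫ s in (0 : ℝ)..t, R (B n (V n s))) atTop
        (𝓝 (∫ s in (0 : ℝ)..t, W s)) := by
      refine intervalIntegral.tendsto_integral_filter_of_dominated_convergence
        (fun _ => 2 * ∫ s in (0 : ℝ)..t, ‖F s‖) (Eventually.of_forall fun n => ?_)
        (Eventually.of_forall fun n => ae_of_all _ fun s hs => ?_) intervalIntegrable_const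
        (ae_of_all _ fun s hs => ?_)
      · exact (R.continuous.comp ((B n).continuous.comp (hVc n))).aestronglyMeasurable
      · rw [uIoc_of_le ht] at hs
        have h1 := (hVle n s hs.1.le).trans (hmono F hF s t hs.1.le hs.2)
        linarith [hRBle n (V n s)]
      · rw [uIoc_of_le ht] at hs
        have h1 := hW s hs.1.le
        have h2 : Tendsto (fun n => R (B n (V n s - W s))) atTop (𝓝 0) := by
          refine squeeze_zero_norm (fun n => hRBle n _) ?_
          simpa using (h1.sub_const (W s)).norm.const_mul 2
        simpa using h2.add (hRBlim (W s))
    have h1 := (R.continuous.tendsto _).comp (hW t ht)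
    refine tendsto_nhds_unique h1 ?_
    have h2 := hlim.add_const (R (∫ s in (0 : ℝ)..t, F s))
    refine h2.congr fun n => ?_
    exact (hid n).symm
  · exact le_of_tendsto (hW t ht).norm (Eventually.of_forall fun n => hVle n t ht)

end MildSolution

/-! ### Sobolev spaces and the Poincaré inequality -/

section Sobolev

variable {d : ℕ} {Ω : Opens (Euc d)}

theorem L2.inner_eq_integral (g h : L2 Ω) :
    inner ℝ g h = ∫ x in (Ω : Set (Euc d)), g x * h x := by
  rw [MeasureTheory.L2.inner_def]
  refine integral_congr_ae (Eventually.of_forall fun x => ?_)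
  simp [mul_comm]

theorem L2.inner_toLp (g : L2 Ω) {h : Euc d → ℝ}
    (hh : MemLp h 2 (volume.restrict (Ω : Set (Euc d)))) :
    inner ℝ g (hh.toLp h) = ∫ x in (Ω : Set (Euc d)), g x * h x := by
  rw [L2.inner_eq_integral]
  refine integral_congr_ae ?_
  filter_upwards [hh.coeFn_toLp] with x hx
  rw [hx]

theorem L2.inner_toLp_toLp {g h : Euc d → ℝ}
    (hg : MemLp g 2 (volume.restrict (Ω : Set (Euc d))))
    (hh : MemLp h 2 (volume.restrict (Ω : Set (Euc d)))) :
    inner ℝ (hg.toLp g) (hh.toLp h) = ∫ x in (Ω : Set (Euc d)), g x * h x := by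
  rw [L2.inner_toLp]
  refine integral_congr_ae ?_
  filter_upwards [hg.coeFn_toLp] with x hx
  rw [hx]

/-- The class in `L²(Ω)` of a test function. -/
def testL2 (φ : 𝓓(Ω, ℝ)) : L2 Ω := (TestFunction.memLp Ω φ).toLp φ

/-- The class in `L²(Ω)` of a partial derivative of a test function. -/
def testDerivL2 (i : Fin d) (φ : 𝓓(Ω, ℝ)) : L2 Ω :=
  (TestFunction.memLp_partialDeriv Ω φ i).toLp (partialDeriv i φ)

theorem isWeakDeriv_iff_inner {i : Fin d} {u v : L2 Ω} :
    IsWeakDeriv Ω i u v ↔ ∀ φ : 𝓓(Ω, ℝ), inner ℝ u (testDerivL2 i φ) = -inner ℝ v (testL2 φ) := by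
  simp only [IsWeakDeriv, testL2, testDerivL2, L2.inner_toLp]

theorem L2.eq_zero_of_inner_test {v : L2 Ω} (h : ∀ φ : 𝓓(Ω, ℝ), inner ℝ v (testL2 φ) = 0) :
    v = 0 := by
  rw [Lp.eq_zero_iff_ae_eq_zero]
  have hloc : LocallyIntegrableOn (v : Euc d → ℝ) (Ω : Set (Euc d)) volume :=
    locallyIntegrableOn_of_locallyIntegrable_restrict
      ((Lp.memLp v).locallyIntegrable (by norm_num))
  have h2 := Ω.isOpen.ae_eq_zero_of_integral_contDiff_smul_eq_zero hloc fun g hg hc hs => by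
    have h3 := h ⟨g, hg, hc, hs⟩
    rw [testL2, L2.inner_toLp] at h3
    rw [← h3, ← setIntegral_eq_integral_of_forall_compl_eq_zero (s := (Ω : Set (Euc d)))]
    · exact integral_congr_ae (Eventually.of_forall fun x => mul_comm _ _)
    · intro x hx
      rw [image_eq_zero_of_notMem_tsupport (fun h => hx (hs h)), zero_smul]
  exact (ae_restrict_iff' Ω.isOpen.measurableSet).2 h2

theorem IsWeakDeriv.unique {i : Fin d} {u v v' : L2 Ω} (h : IsWeakDeriv Ω i u v)
    (h' : IsWeakDeriv Ω i u v') : v = v' := by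
  rw [← sub_eq_zero]
  refine L2.eq_zero_of_inner_test fun φ => ?_
  rw [isWeakDeriv_iff_inner] at h h'
  rw [inner_sub_left]
  linarith [h φ, h' φ]

theorem isClosed_H1 : IsClosed (H1 Ω : Set (WithLp 2 (L2 Ω × PiLp 2 (fun _ : Fin d => L2 Ω)))) := by
  have : (H1 Ω : Set (WithLp 2 (L2 Ω × PiLp 2 (fun _ : Fin d => L2 Ω)))) =
      ⋂ (i : Fin d) (φ : 𝓓(Ω, ℝ)), {p | inner ℝ p.fst (testDerivL2 i φ) =
        -inner ℝ (p.snd i) (testL2 φ)} := by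
    ext p
    simp only [mem_iInter, mem_ofPred_eq]
    exact forall_congr' fun i => isWeakDeriv_iff_inner
  rw [this]
  refine isClosed_iInter fun i => isClosed_iInter fun φ => isClosed_eq ?_ ?_
  · fun_prop
  · fun_prop

instance : CompleteSpace (H1 Ω) := isClosed_H1.completeSpace_coe

instance : CompleteSpace (H10 Ω) :=
  (Submodule.isClosed_topologicalClosure (H1.testFunctions Ω)).completeSpace_coe

theorem H1.isWeakDeriv_grad (u : H1 Ω) (i : Fin d) :
    IsWeakDeriv Ω i (H1.toL2 Ω u) (H1.grad Ω u i) := u.2 i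

theorem H1.norm_sq (u : H1 Ω) : ‖u‖ ^ 2 = ‖H1.toL2 Ω u‖ ^ 2 + ‖H1.grad Ω u‖ ^ 2 :=
  WithLp.prod_norm_sq_eq_of_L2 u.1

theorem H1.toL2_injective : Function.Injective (H1.toL2 Ω) := by
  refine (injective_iff_map_eq_zero _).2 fun u hu => ?_
  have h : H1.grad Ω u = 0 := by
    ext1 i
    have h1 := H1.isWeakDeriv_grad u i
    rw [hu] at h1
    exact h1.unique (IsWeakDeriv.zero Ω i)
  have := H1.norm_sq u
  rw [hu, h] at this
  simpa using this

theorem H10.toL2_injective : Function.Injective (H10.toL2 Ω) :=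
  H1.toL2_injective.comp Subtype.val_injective

theorem H10.norm_sq (u : H10 Ω) : ‖u‖ ^ 2 = ‖H10.toL2 Ω u‖ ^ 2 + ‖H10.grad Ω u‖ ^ 2 :=
  H1.norm_sq u.1

theorem integral_mul_partialDeriv {g ψ : Euc d → ℝ} (hg : ContDiff ℝ 1 g)
    (hψ : ContDiff ℝ 1 ψ) (hc : HasCompactSupport ψ) (i : Fin d) :
    ∫ x, g x * partialDeriv i ψ x = -∫ x, partialDeriv i g x * ψ x := by
  have hg' : Continuous fun x => fderiv ℝ g x (EuclideanSpace.single i 1) :=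
    (hg.continuous_fderiv (by simp)).clm_apply continuous_const
  have hψ' : Continuous fun x => fderiv ℝ ψ x (EuclideanSpace.single i 1) :=
    (hψ.continuous_fderiv (by simp)).clm_apply continuous_const
  refine integral_mul_fderiv_eq_neg_fderiv_mul_of_integrable
    ((hg'.mul hψ.continuous).integrable_of_hasCompactSupport hc.mul_left)
    ((hg.continuous.mul hψ').integrable_of_hasCompactSupport
      (hc.fderiv_apply (𝕜 := ℝ) _).mul_left)
    ((hg.continuous.mul hψ.continuous).integrable_of_hasCompactSupport hc.mul_left)
    (fun x _ => hg.differentiable (by simp) x) (fun x _ => hψ.differentiable (by simp) x)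

theorem partialDeriv_eq_zero_of_notMem_tsupport {ψ : Euc d → ℝ} {x : Euc d}
    (hx : x ∉ tsupport ψ) (i : Fin d) : partialDeriv i ψ x = 0 := by
  rw [partialDeriv, fderiv_of_notMem_tsupport (𝕜 := ℝ) hx, zero_apply]

/-- Integration by parts on `Ω` against a test function. -/
theorem setIntegral_mul_partialDeriv {g : Euc d → ℝ} (hg : ContDiff ℝ 1 g)
    (φ : 𝓓(Ω, ℝ)) (i : Fin d) :
    ∫ x in (Ω : Set (Euc d)), g x * partialDeriv i φ x =
      -∫ x in (Ω : Set (Euc d)), partialDeriv i g x * φ x := by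
  rw [setIntegral_eq_integral_of_forall_compl_eq_zero,
    setIntegral_eq_integral_of_forall_compl_eq_zero]
  · exact integral_mul_partialDeriv hg (φ.contDiff.of_le (by simp)) φ.hasCompactSupport i
  · intro x hx
    rw [image_eq_zero_of_notMem_tsupport (fun h => hx (φ.tsupport_subset h)), mul_zero]
  · intro x hx
    rw [partialDeriv_eq_zero_of_notMem_tsupport (fun h => hx (φ.tsupport_subset h)), mul_zero]

theorem isWeakDeriv_toLp {g : Euc d → ℝ} (hg : ContDiff ℝ 1 g) {i : Fin d}
    (h1 : MemLp g 2 (volume.restrict (Ω : Set (Euc d))))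
    (h2 : MemLp (partialDeriv i g) 2 (volume.restrict (Ω : Set (Euc d)))) :
    IsWeakDeriv Ω i (h1.toLp g) (h2.toLp _) := by
  rw [isWeakDeriv_iff_inner]
  intro φ
  rw [testL2, testDerivL2, L2.inner_toLp_toLp, L2.inner_toLp_toLp]
  exact setIntegral_mul_partialDeriv hg φ i

/-- A continuously differentiable function, square integrable on `Ω` together with its partial
derivatives, as an element of `H¹(Ω)`. -/
def H1.ofContDiff {g : Euc d → ℝ} (hg : ContDiff ℝ 1 g)
    (h1 : MemLp g 2 (volume.restrict (Ω : Set (Euc d))))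
    (h2 : ∀ i, MemLp (partialDeriv i g) 2 (volume.restrict (Ω : Set (Euc d)))) : H1 Ω :=
  ⟨WithLp.toLp 2 (h1.toLp g, WithLp.toLp 2 fun i => (h2 i).toLp _),
    fun i => isWeakDeriv_toLp hg h1 (h2 i)⟩

/-- A test function as an element of `H¹₀(Ω)`. -/
def testH10 (φ : 𝓓(Ω, ℝ)) : H10 Ω :=
  ⟨H1.ofContDiff (φ.contDiff.of_le (by simp)) (TestFunction.memLp Ω φ)
    (TestFunction.memLp_partialDeriv Ω φ),
    Submodule.le_topologicalClosure _ ⟨φ, (TestFunction.memLp Ω φ).coeFn_toLp⟩⟩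

theorem H10.toL2_testH10 (φ : 𝓓(Ω, ℝ)) : H10.toL2 Ω (testH10 φ) = testL2 φ := rfl

theorem H10.grad_testH10 (φ : 𝓓(Ω, ℝ)) (i : Fin d) :
    H10.grad Ω (testH10 φ) i = testDerivL2 i φ := rfl

theorem H10.denseRange_toL2 : DenseRange (H10.toL2 Ω) := by
  have h : (LinearMap.range (H10.toL2 Ω : H10 Ω →ₗ[ℝ] L2 Ω)).topologicalClosure = ⊤ := by
    rw [Submodule.topologicalClosure_eq_top_iff, Submodule.eq_bot_iff]
    intro v hv
    refine L2.eq_zero_of_inner_test fun φ => ?_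
    rw [real_inner_comm]
    exact hv (testL2 φ) ⟨testH10 φ, rfl⟩
  exact (Submodule.dense_iff_topologicalClosure_eq_top).2 h

/-- Density of the test functions, in the form of an induction principle. -/
theorem H10.induction_closed {P : H10 Ω → Prop} (hP : IsClosed {u | P u})
    (h : ∀ φ : 𝓓(Ω, ℝ), P (testH10 φ)) (u : H10 Ω) : P u := by
  obtain ⟨u, hu⟩ := u
  have hu' : u ∈ closure (H1.testFunctions Ω : Set (H1 Ω)) := hu
  obtain ⟨s, hs, hlim⟩ := mem_closure_iff_seq_limit.1 hu'
  have hmem : ∀ n, s n ∈ H10 Ω := fun n => Submodule.le_topologicalClosure _ (hs n)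
  have h1 : Tendsto (fun n => (⟨s n, hmem n⟩ : H10 Ω)) atTop (𝓝 ⟨u, hu⟩) :=
    tendsto_subtype_rng.2 hlim
  refine hP.mem_of_tendsto h1 (Eventually.of_forall fun n => ?_)
  obtain ⟨φ, hφ⟩ := hs n
  have h2 : (⟨s n, hmem n⟩ : H10 Ω) = testH10 φ := by
    refine H10.toL2_injective ?_
    rw [H10.toL2_testH10]
    exact Lp.ext (hφ.trans (TestFunction.memLp Ω φ).coeFn_toLp.symm)
  rw [mem_ofPred_eq, h2]
  exact h φ

theorem contDiff_coord (i : Fin d) {n : WithTop ℕ∞} : ContDiff ℝ n fun x : Euc d => x i := by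
  fun_prop

theorem partialDeriv_coord (i j : Fin d) (x : Euc d) :
    partialDeriv i (fun y => y j) x = if j = i then 1 else 0 := by
  have h : HasFDerivAt (fun y : Euc d => y j) (EuclideanSpace.proj j : Euc d →L[ℝ] ℝ) x :=
    (EuclideanSpace.proj (𝕜 := ℝ) j).hasFDerivAt
  rw [partialDeriv, h.fderiv]
  simp

theorem partialDeriv_mul {g h : Euc d → ℝ} {x : Euc d} (hg : DifferentiableAt ℝ g x)
    (hh : DifferentiableAt ℝ h x) (i : Fin d) :
    partialDeriv i (fun y => g y * h y) x =
      g x * partialDeriv i h x + partialDeriv i g x * h x := by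
  rw [partialDeriv, fderiv_fun_mul hg hh]
  simp [partialDeriv, mul_comm]

/-- The Poincaré inequality for a test function, from
`∫ φ² = ∫ φ² ∂ᵢ xᵢ = -2 ∫ xᵢ φ ∂ᵢφ`. -/
theorem norm_testL2_le {M : ℝ} (hM : ∀ x ∈ (Ω : Set (Euc d)), ‖x‖ ≤ M) (i : Fin d) (φ : 𝓓(Ω, ℝ)) :
    ‖testL2 φ‖ ≤ 2 * M * ‖testDerivL2 i φ‖ := by
  have hφ : ContDiff ℝ 1 (φ : Euc d → ℝ) := φ.contDiff.of_le (by simp)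
  have hx : ContDiff ℝ 1 fun x : Euc d => x i := contDiff_coord i
  have hb : ∀ᵐ x ∂(volume.restrict (Ω : Set (Euc d))),
      ‖x i * partialDeriv i φ x‖ ≤ M * ‖partialDeriv i φ x‖ := by
    refine (ae_restrict_iff' Ω.isOpen.measurableSet).2 (ae_of_all _ fun x hx => ?_)
    rw [norm_mul]
    exact mul_le_mul_of_nonneg_right ((PiLp.norm_apply_le x i).trans (hM x hx)) (norm_nonneg _)
  have hd : Continuous (partialDeriv i (φ : Euc d → ℝ)) :=
    (φ.contDiff.continuous_fderiv (by simp)).clm_apply continuous_const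
  have hmem : MemLp (fun x => x i * partialDeriv i φ x) 2 (volume.restrict (Ω : Set (Euc d))) :=
    (TestFunction.memLp_partialDeriv Ω φ i).of_le_mul
      (hx.continuous.mul hd).aestronglyMeasurable hb
  have hnorm : ‖hmem.toLp _‖ ≤ M * ‖testDerivL2 i φ‖ := by
    refine Lp.norm_le_mul_norm_of_ae_le_mul ?_
    filter_upwards [hb, hmem.coeFn_toLp, (TestFunction.memLp_partialDeriv Ω φ i).coeFn_toLp]
      with x h1 h2 h3
    rw [h2, testDerivL2, h3]
    exact h1
  have hself : ‖testL2 φ‖ ^ 2 = -2 * inner ℝ (testL2 φ) (hmem.toLp _) := by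
    rw [← real_inner_self_eq_norm_sq, testL2, L2.inner_toLp_toLp, L2.inner_toLp_toLp]
    have h1 := setIntegral_mul_partialDeriv (hx.mul hφ) φ i
    have h2 : ∀ x, partialDeriv i (fun y => y i * φ y) x * φ x =
        φ x * (x i * partialDeriv i φ x) + φ x * φ x := fun x => by
      rw [partialDeriv_mul (hx.differentiable (by simp) x) (hφ.differentiable (by simp) x),
        partialDeriv_coord]
      simp; ring
    have i1 : Integrable (fun x => φ x * (x i * partialDeriv i φ x))
        (volume.restrict (Ω : Set (Euc d))) := (TestFunction.memLp Ω φ).integrable_mul hmem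
    have i2 : Integrable (fun x => φ x * φ x) (volume.restrict (Ω : Set (Euc d))) :=
      (TestFunction.memLp Ω φ).integrable_mul (TestFunction.memLp Ω φ)
    simp only [h2] at h1
    rw [integral_add i1 i2] at h1
    have h3 : ∫ x in (Ω : Set (Euc d)), x i * φ x * partialDeriv i φ x =
        ∫ x in (Ω : Set (Euc d)), φ x * (x i * partialDeriv i φ x) :=
      integral_congr_ae (ae_of_all _ fun x => by ring)
    rw [h3] at h1
    linarith
  have h4 := (abs_le.1 (abs_real_inner_le_norm (testL2 φ) (hmem.toLp _))).1
  have h5 : ‖testL2 φ‖ * ‖testL2 φ‖ ≤ ‖testL2 φ‖ * (2 * M * ‖testDerivL2 i φ‖) := by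
    have := mul_le_mul_of_nonneg_left hnorm (norm_nonneg (testL2 φ))
    nlinarith
  by_cases h0 : ‖testL2 φ‖ = 0
  · rw [h0]
    nlinarith [norm_nonneg (hmem.toLp _)]
  · exact le_of_mul_le_mul_left h5 (lt_of_le_of_ne (norm_nonneg _) (Ne.symm h0))

/-- The Poincaré inequality. -/
theorem H10.exists_norm_toL2_le (hd : 0 < d) (hΩ : Bornology.IsBounded (Ω : Set (Euc d))) :
    ∃ C : ℝ, 0 ≤ C ∧ ∀ u : H10 Ω, ‖H10.toL2 Ω u‖ ≤ C * ‖H10.grad Ω u‖ := by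
  obtain ⟨M, hM0, hM⟩ := hΩ.exists_pos_norm_le
  refine ⟨2 * M, by positivity, H10.induction_closed (isClosed_le (by fun_prop) (by fun_prop))
    fun φ => (norm_testL2_le hM ⟨0, hd⟩ φ).trans ?_⟩
  refine mul_le_mul_of_nonneg_left ?_ (by positivity)
  exact PiLp.norm_apply_le (H10.grad Ω (testH10 φ)) ⟨0, hd⟩

end Sobolev

/-! ### The wave equation on the energy space -/

section AbstractWave

variable {W H : Type*} [NormedAddCommGroup W] [InnerProductSpace ℝ W] [CompleteSpace W]
  [NormedAddCommGroup H] [InnerProductSpace ℝ H] [CompleteSpace H]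

/-- The operator `(u, v) ↦ (-j* v, j u)` on the energy space `W × H`. It is the inverse of the
generator `(u, v) ↦ (v, -A u)` of the wave group, where `A⁻¹ = j j*`. -/
def waveInverse (j : W →L[ℝ] H) : WithLp 2 (W × H) →L[ℝ] WithLp 2 (W × H) :=
  ((WithLp.prodContinuousLinearEquiv 2 ℝ W H).symm : W × H →L[ℝ] WithLp 2 (W × H)).comp
    ((-(j.adjoint.comp (WithLp.sndL 2 ℝ W H))).prod (j.comp (WithLp.fstL 2 ℝ W H)))

theorem waveInverse_fst (j : W →L[ℝ] H) (x : WithLp 2 (W × H)) :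
    (waveInverse j x).fst = -j.adjoint x.snd := rfl

theorem waveInverse_snd (j : W →L[ℝ] H) (x : WithLp 2 (W × H)) :
    (waveInverse j x).snd = j x.fst := rfl

theorem inner_waveInverse_self (j : W →L[ℝ] H) (x : WithLp 2 (W × H)) :
    inner ℝ (waveInverse j x) x = 0 := by
  rw [WithLp.prod_inner_apply]
  change inner ℝ (waveInverse j x).fst x.fst + inner ℝ (waveInverse j x).snd x.snd = 0
  rw [waveInverse_fst, waveInverse_snd, inner_neg_left, ContinuousLinearMap.adjoint_inner_left,
    real_inner_comm]
  ring

theorem adjoint_injective_of_denseRange {j : W →L[ℝ] H} (hd : DenseRange j) :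
    Function.Injective j.adjoint := by
  refine (injective_iff_map_eq_zero _).2 fun v hv => ?_
  refine hd.eq_zero_of_inner_left ℝ fun w => ?_
  rw [← ContinuousLinearMap.adjoint_inner_left, hv, inner_zero_left]

theorem waveInverse_injective {j : W →L[ℝ] H} (hj : Function.Injective j) (hd : DenseRange j) :
    Function.Injective (waveInverse j) := by
  refine (injective_iff_map_eq_zero _).2 fun x hx => ?_
  have h1 : j x.fst = 0 := by rw [← waveInverse_snd, hx]; rfl
  have h2 : j.adjoint x.snd = 0 := by
    rw [← neg_eq_zero, ← waveInverse_fst, hx]; rfl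
  have h3 : x.fst = 0 := hj (by simpa using h1)
  have h4 : x.snd = 0 := adjoint_injective_of_denseRange hd (by simpa using h2)
  exact (WithLp.ofLp_injective 2) (Prod.ext h3 h4)

/-- The wave equation `(j* j u)'' = -u + j* f`, `u(0) = 0`, `(j u)'(0) = 0` in integrated form,
written as a first-order system for `u` and the velocity `v = (j u)'`. -/
theorem exists_wave_solution {j : W →L[ℝ] H} (hj : Function.Injective j) (hd : DenseRange j)
    {f : ℝ → H} (hf : Continuous f) :
    ∃ (u : ℝ → W) (v : ℝ → H), ContinuousOn u (Ici 0) ∧ ContinuousOn v (Ici 0) ∧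
      (∀ t, 0 ≤ t → j (u t) = ∫ s in (0 : ℝ)..t, v s) ∧
      (∀ t, 0 ≤ t → j.adjoint (v t) = -(∫ s in (0 : ℝ)..t, u s) +
        j.adjoint (∫ s in (0 : ℝ)..t, f s)) ∧
      ∀ t, 0 ≤ t → ‖u t‖ ≤ ∫ s in (0 : ℝ)..t, ‖f s‖ := by
  let F : ℝ → WithLp 2 (W × H) := fun t => WithLp.toLp 2 (0, f t)
  have hF : Continuous F := by fun_prop
  obtain ⟨U, hUc, hU, hUle⟩ := exists_mild_solution (inner_waveInverse_self j)
    (waveInverse_injective hj hd) hF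
  have hint : ∀ t, 0 ≤ t → IntervalIntegrable U volume 0 t := fun t ht =>
    (hUc.mono (by rw [uIcc_of_le ht]; exact Icc_subset_Ici_self)).intervalIntegrable
  have hfst : ∀ t, 0 ≤ t → (∫ s in (0 : ℝ)..t, U s).fst = ∫ s in (0 : ℝ)..t, (U s).fst :=
    fun t ht => ((WithLp.fstL 2 ℝ W H).intervalIntegral_comp_comm (hint t ht)).symm
  have hsnd : ∀ t, 0 ≤ t → (∫ s in (0 : ℝ)..t, U s).snd = ∫ s in (0 : ℝ)..t, (U s).snd :=
    fun t ht => ((WithLp.sndL 2 ℝ W H).intervalIntegral_comp_comm (hint t ht)).symm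
  have hFfst : ∀ t, (∫ s in (0 : ℝ)..t, F s).fst = 0 := fun t => by
    have := ((WithLp.fstL 2 ℝ W H).intervalIntegral_comp_comm
      (hF.intervalIntegrable (μ := volume) 0 t)).symm
    refine this.trans ?_
    exact intervalIntegral.integral_zero
  have hFsnd : ∀ t, (∫ s in (0 : ℝ)..t, F s).snd = ∫ s in (0 : ℝ)..t, f s := fun t =>
    ((WithLp.sndL 2 ℝ W H).intervalIntegral_comp_comm (hF.intervalIntegrable 0 t)).symm
  have hFn : ∀ s, ‖F s‖ = ‖f s‖ := fun s => WithLp.norm_toLp_snd 2 W H (f s)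
  refine ⟨fun t => (U t).fst, fun t => (U t).snd, by fun_prop, by fun_prop,
    fun t ht => ?_, fun t ht => ?_, fun t ht => ?_⟩
  · have h := congrArg WithLp.snd (hU t ht)
    rw [waveInverse_snd, WithLp.add_snd, hsnd t ht, waveInverse_snd, hFfst, map_zero,
      add_zero] at h
    exact h
  · have h := congrArg WithLp.fst (hU t ht)
    rw [waveInverse_fst, WithLp.add_fst, hfst t ht, waveInverse_fst, hFsnd] at h
    have := congrArg Neg.neg h
    rw [neg_neg] at this
    rw [this]; abel
  · refine (WithLp.norm_fst_le W (U t)).trans ((hUle t ht).trans_eq ?_)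
    simp only [hFn]

theorem wave_solution_eq_zero {j : W →L[ℝ] H} (hj : Function.Injective j) (hd : DenseRange j)
    {u : ℝ → W} {v : ℝ → H} (hu : ContinuousOn u (Ici 0)) (hv : ContinuousOn v (Ici 0))
    (h1 : ∀ t, 0 ≤ t → j (u t) = ∫ s in (0 : ℝ)..t, v s)
    (h2 : ∀ t, 0 ≤ t → j.adjoint (v t) = -∫ s in (0 : ℝ)..t, u s) {t : ℝ} (ht : 0 ≤ t) :
    u t = 0 := by
  let U : ℝ → WithLp 2 (W × H) := fun t => WithLp.toLp 2 (u t, v t)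
  have hU : ContinuousOn U (Ici 0) := by fun_prop
  have hint : ∀ t, 0 ≤ t → IntervalIntegrable U volume 0 t := fun t ht =>
    (hU.mono (by rw [uIcc_of_le ht]; exact Icc_subset_Ici_self)).intervalIntegrable
  have h := eq_zero_of_skew_integral (inner_waveInverse_self j) (waveInverse_injective hj hd) hU
    (fun t ht => by
      have hfst := (WithLp.fstL 2 ℝ W H).intervalIntegral_comp_comm (hint t ht)
      have hsnd := (WithLp.sndL 2 ℝ W H).intervalIntegral_comp_comm (hint t ht)
      refine (WithLp.ofLp_injective 2) (Prod.ext ?_ ?_)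
      · refine Eq.trans ?_ hfst
        change -j.adjoint (v t) = ∫ s in (0 : ℝ)..t, u s
        rw [h2 t ht, neg_neg]
      · refine Eq.trans ?_ hsnd
        exact h1 t ht) ht
  exact congrArg WithLp.fst h

end AbstractWave

/-! ### Weak solutions in a Gelfand triple -/

section Calculus

variable {E : Type*} [NormedAddCommGroup E]

theorem intervalIntegrable_of_continuousOn_Ici {f : ℝ → E} (h : ContinuousOn f (Ici 0)) {t : ℝ}
    (ht : 0 ≤ t) : IntervalIntegrable f volume 0 t :=
  (h.mono (by rw [uIcc_of_le ht]; exact Icc_subset_Ici_self)).intervalIntegrable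

theorem continuous_comp_max {f : ℝ → E} (h : ContinuousOn f (Ici 0)) :
    Continuous fun t => f (max t 0) :=
  h.comp_continuous (by fun_prop) fun t => le_max_right t 0

variable [NormedSpace ℝ E]

theorem integral_congr_of_nonneg {f g : ℝ → E} (h : ∀ s, 0 ≤ s → f s = g s) {t : ℝ} (ht : 0 ≤ t) :
    ∫ s in (0 : ℝ)..t, f s = ∫ s in (0 : ℝ)..t, g s := by
  refine intervalIntegral.integral_congr fun s hs => ?_
  rw [uIcc_of_le ht] at hs
  exact h s hs.1

variable [CompleteSpace E]

theorem contDiff_one_integral {g : ℝ → E} (hg : Continuous g) :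
    ContDiff ℝ 1 fun t => ∫ s in (0 : ℝ)..t, g s := by
  have hd : ∀ t, HasDerivAt (fun t => ∫ s in (0 : ℝ)..t, g s) (g t) t := fun t =>
    (hg.integral_hasStrictDerivAt 0 t).hasDerivAt
  rw [contDiff_one_iff_deriv]
  exact ⟨fun t => (hd t).differentiableAt, by rwa [funext fun t => (hd t).deriv]⟩

theorem deriv_integral_zero {g : ℝ → E} (hg : Continuous g) :
    deriv (fun t => ∫ s in (0 : ℝ)..t, g s) = g :=
  funext fun t => (hg.integral_hasStrictDerivAt 0 t).hasDerivAt.deriv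

theorem contDiff_two_integral_integral {g : ℝ → E} (hg : Continuous g) :
    ContDiff ℝ 2 fun t => ∫ s in (0 : ℝ)..t, ∫ r in (0 : ℝ)..s, g r := by
  have h1 := contDiff_one_integral hg
  have h2 := contDiff_one_integral h1.continuous
  rw [show (2 : WithTop ℕ∞) = 1 + 1 by norm_num, contDiff_succ_iff_deriv]
  refine ⟨h2.differentiable (by simp), by simp, ?_⟩
  rw [deriv_integral_zero h1.continuous]
  exact h1

theorem iteratedDeriv_two_integral_integral {g : ℝ → E} (hg : Continuous g) :
    iteratedDeriv 2 (fun t => ∫ s in (0 : ℝ)..t, ∫ r in (0 : ℝ)..s, g r) = g := by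
  rw [iteratedDeriv_succ, iteratedDeriv_one,
    deriv_integral_zero (contDiff_one_integral hg).continuous, deriv_integral_zero hg]

theorem integral_derivWithin_Ici {y : ℝ → E} (hy : ContDiffOn ℝ 1 y (Ici 0)) {t : ℝ}
    (ht : 0 ≤ t) : ∫ s in (0 : ℝ)..t, derivWithin y (Ici 0) s = y t - y 0 := by
  have hc := hy.continuousOn_derivWithin (uniqueDiffOn_Ici 0) le_rfl
  refine intervalIntegral.integral_eq_sub_of_hasDeriv_right_of_le ht
    (hy.continuousOn.mono Icc_subset_Ici_self) (fun x hx => ?_)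
    (hc.mono (by rw [uIcc_of_le ht]; exact Icc_subset_Ici_self)).intervalIntegrable
  have h := (hy.differentiableOn (by simp) x hx.1.le).hasDerivWithinAt
  exact h.mono fun z hz => hx.1.le.trans (mem_Ioi.1 hz).le

end Calculus

section DualWave

variable {V W H : Type*} [NormedAddCommGroup V] [NormedSpace ℝ V]
  [NormedAddCommGroup W] [InnerProductSpace ℝ W]
  [NormedAddCommGroup H] [InnerProductSpace ℝ H]

/-- A weak solution of `ü = A u + f`, `u(0) = u̇(0) = 0`, for a Gelfand triple `V ⊂ H ⊂ V*` with
embeddings `S : V → H` and `T : H → V*`. -/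
structure IsDualWaveSolution (S : V →L[ℝ] H) (T : H → StrongDual ℝ V) (A : V → StrongDual ℝ V)
    (f : ℝ → H) (u : ℝ → V) : Prop where
  contDiffOn_dual : ContDiffOn ℝ 2 (fun t => T (S (u t))) (Ici 0)
  contDiffOn_mid : ContDiffOn ℝ 1 (fun t => S (u t)) (Ici 0)
  continuousOn : ContinuousOn u (Ici 0)
  wave_eq : ∀ t : ℝ, 0 ≤ t →
    iteratedDerivWithin 2 (fun s => T (S (u s))) (Ici 0) t = A (u t) + T (f t)
  initial_value : u 0 = 0
  initial_velocity : derivWithin (fun t => S (u t)) (Ici 0) 0 = 0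

/-- The Riesz map `W ≅ V*` obtained from an identification of `V` with a Hilbert space `W`. -/
def rieszDual (e : V ≃L[ℝ] W) : W →L[ℝ] StrongDual ℝ V :=
  (ContinuousLinearMap.precomp ℝ (e : V →L[ℝ] W)).comp (innerSL ℝ)

theorem rieszDual_apply (e : V ≃L[ℝ] W) (w : W) (v : V) :
    rieszDual e w v = inner ℝ w (e v) := rfl

theorem rieszDual_injective (e : V ≃L[ℝ] W) : Function.Injective (rieszDual e) := by
  refine (injective_iff_map_eq_zero _).2 fun w hw => ?_
  have h := rieszDual_apply e w (e.symm w)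
  rw [hw, ContinuousLinearEquiv.apply_symm_apply] at h
  exact inner_self_eq_zero.1 h.symm

variable [CompleteSpace W] [CompleteSpace H] {e : V ≃L[ℝ] W} {j : W →L[ℝ] H}
  {S : V →L[ℝ] H} {T : H → StrongDual ℝ V} {A : V → StrongDual ℝ V}

/-- A weak solution satisfies the integrated first-order system. -/
theorem IsDualWaveSolution.integrated
    (hS : ∀ u, j (e u) = S u) (hT : ∀ g, T g = rieszDual e (j.adjoint g))
    (hA : ∀ u, A u = rieszDual e (-e u))
    {f : ℝ → H} (hf : ContinuousOn f (Ici 0)) {a : ℝ → V} (ha : IsDualWaveSolution S T A f a) :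
    ∃ b : ℝ → H, ContinuousOn b (Ici 0) ∧
      (∀ t, 0 ≤ t → j (e (a t)) = ∫ s in (0 : ℝ)..t, b s) ∧
      ∀ t, 0 ≤ t → j.adjoint (b t) =
        ∫ s in (0 : ℝ)..t, (-e (a s) + j.adjoint (f s)) := by
  let b : ℝ → H := derivWithin (fun t => S (a t)) (Ici 0)
  let ι := rieszDual e
  let J := j.adjoint
  have huniq : UniqueDiffOn ℝ (Ici (0 : ℝ)) := uniqueDiffOn_Ici 0
  have hb : ContinuousOn b (Ici 0) := ha.contDiffOn_mid.continuousOn_derivWithin huniq le_rfl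
  refine ⟨b, hb, fun t ht => ?_, fun t ht => ?_⟩
  · rw [hS, integral_derivWithin_Ici ha.contDiffOn_mid ht, ha.initial_value,
      map_zero, sub_zero]
  · let y : ℝ → StrongDual ℝ V := fun t => T (S (a t))
    have hy1 : ∀ t ∈ Ici (0 : ℝ), derivWithin y (Ici 0) t = ι (J (b t)) := fun t ht => by
      have h1 : HasDerivWithinAt (fun t => S (a t)) (b t) (Ici 0) t :=
        (ha.contDiffOn_mid.differentiableOn (by simp) t ht).hasDerivWithinAt
      have h2 := (ι.comp J).hasFDerivAt.comp_hasDerivWithinAt t h1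
      have h3 : y = ⇑(ι.comp J) ∘ fun t => S (a t) :=
        funext fun t => hT _
      rw [h3]
      exact h2.derivWithin (huniq t ht)
    have hy2 : ContDiffOn ℝ 1 (derivWithin y (Ici 0)) (Ici 0) := by
      have h1 : ContDiffOn ℝ (1 + 1) y (Ici 0) := by
        simpa [one_add_one_eq_two] using ha.contDiffOn_dual
      exact ((contDiffOn_succ_iff_derivWithin huniq).1 h1).2.2
    have h3 := integral_derivWithin_Ici hy2 ht
    rw [hy1 t ht, hy1 0 self_mem_Ici,
      show b 0 = 0 from ha.initial_velocity, map_zero, map_zero, sub_zero] at h3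
    have h4 : ∀ s, 0 ≤ s → derivWithin (derivWithin y (Ici 0)) (Ici 0) s =
        ι (-e (a s) + J (f s)) := fun s hs => by
      have h5 := ha.wave_eq s hs
      rw [iteratedDerivWithin_succ, iteratedDerivWithin_one,
        hA, hT, ← map_add] at h5
      exact h5
    have hc : ContinuousOn (fun s => -e (a s) + J (f s)) (Ici 0) := by
      have := ha.continuousOn
      exact (e.continuous.comp_continuousOn this).neg.add
        (J.continuous.comp_continuousOn hf)
    rw [integral_congr_of_nonneg h4 ht,
      ι.intervalIntegral_comp_comm (intervalIntegrable_of_continuousOn_Ici hc ht)] at h3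
    exact (rieszDual_injective e h3).symm

theorem IsDualWaveSolution.unique (hj : Function.Injective j) (hdense : DenseRange j)
    (hS : ∀ u, j (e u) = S u) (hT : ∀ g, T g = rieszDual e (j.adjoint g))
    (hA : ∀ u, A u = rieszDual e (-e u))
    {f : ℝ → H} (hf : ContinuousOn f (Ici 0)) {a a' : ℝ → V} (ha : IsDualWaveSolution S T A f a)
    (ha' : IsDualWaveSolution S T A f a') {t : ℝ} (ht : 0 ≤ t) : a t = a' t := by
  obtain ⟨b, hb, h1, h2⟩ := ha.integrated hS hT hA hf
  obtain ⟨b', hb', h1', h2'⟩ := ha'.integrated hS hT hA hf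
  let J := j.adjoint
  have hc : ∀ c : ℝ → V, ContinuousOn c (Ici 0) →
      ContinuousOn (fun s => e (c s)) (Ici 0) := fun c hc =>
    e.continuous.comp_continuousOn hc
  have hcJ : ContinuousOn (fun s => J (f s)) (Ici 0) := J.continuous.comp_continuousOn hf
  have ce := hc a ha.continuousOn
  have ce' := hc a' ha'.continuousOn
  have h := wave_solution_eq_zero hj hdense
    (u := fun s => e (a s) - e (a' s)) (v := fun s => b s - b' s)
    (ce.sub ce') (hb.sub hb')
    (fun t ht => by
      rw [map_sub, h1 t ht, h1' t ht, intervalIntegral.integral_sub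
        (intervalIntegrable_of_continuousOn_Ici hb ht)
        (intervalIntegrable_of_continuousOn_Ici hb' ht)])
    (fun t ht => by
      rw [map_sub, h2 t ht, h2' t ht, ← intervalIntegral.integral_sub
        (intervalIntegrable_of_continuousOn_Ici (f := fun s => -e (a s) + J (f s))
          (ce.neg.add hcJ) ht)
        (intervalIntegrable_of_continuousOn_Ici (f := fun s => -e (a' s) + J (f s))
          (ce'.neg.add hcJ) ht),
        ← intervalIntegral.integral_neg]
      refine intervalIntegral.integral_congr fun s _ => ?_
      abel) ht
  exact e.injective (sub_eq_zero.1 h)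

variable [CompleteSpace V]

theorem exists_dualWaveSolution (hj : Function.Injective j) (hdense : DenseRange j)
    (hS : ∀ u, j (e u) = S u) (hT : ∀ g, T g = rieszDual e (j.adjoint g))
    (hA : ∀ u, A u = rieszDual e (-e u))
    {f : ℝ → H} (hf : ContinuousOn f (Ici 0)) :
    ∃ u : ℝ → V, IsDualWaveSolution S T A f u ∧
      (∀ v : ℝ → V, IsDualWaveSolution S T A f v → ∀ t : ℝ, 0 ≤ t → v t = u t) ∧
      (∀ t : ℝ, 0 ≤ t → ‖e (u t)‖ ≤ ∫ τ in (0 : ℝ)..t, ‖f τ‖) ∧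
      ∃ (w : ℝ → V) (z : ℝ → H), Continuous w ∧ Continuous z ∧ (∀ t, A (w t) = T (z t)) ∧
        ∀ t : ℝ, 0 ≤ t → S (w t) = ∫ τ in (0 : ℝ)..t, S (u τ) := by
  let ι := rieszDual e
  let J := j.adjoint
  have hF := continuous_comp_max hf
  obtain ⟨U, v, hU, hv, h1, h2, h3⟩ := exists_wave_solution hj
    hdense hF
  have hmax : ∀ s : ℝ, 0 ≤ s → f (max s 0) = f s := fun s hs => by rw [max_eq_left hs]
  have hVc := continuous_comp_max hv
  have hUc := continuous_comp_max hU
  -- the second derivative of the solution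
  let g : ℝ → StrongDual ℝ V := fun s => ι (-U (max s 0) + J (f (max s 0)))
  have hg0 : Continuous fun s => -U (max s 0) + J (f (max s 0)) :=
    hUc.neg.add (J.continuous.comp hF)
  have hg : Continuous g := ι.continuous.comp hg0
  have hjv : ∀ t, 0 ≤ t → j (U t) = ∫ s in (0 : ℝ)..t, v (max s 0) := fun t ht => by
    refine (h1 t ht).trans (integral_congr_of_nonneg (fun s hs => ?_) ht)
    rw [max_eq_left hs]
  have hJv : ∀ t, 0 ≤ t → ι (J (v t)) = ∫ s in (0 : ℝ)..t, g s := fun t ht => by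
    have h4 : J (v t) = ∫ s in (0 : ℝ)..t, (-U (max s 0) + J (f (max s 0))) := by
      have i1 : IntervalIntegrable (fun s => -U (max s 0)) volume 0 t :=
        hUc.neg.intervalIntegrable _ _
      have i2 : IntervalIntegrable (fun s => J (f (max s 0))) volume 0 t :=
        (J.continuous.comp hF).intervalIntegrable _ _
      rw [intervalIntegral.integral_add i1 i2, intervalIntegral.integral_neg]
      refine (h2 t ht).trans ?_
      congr 1
      · congr 1
        exact integral_congr_of_nonneg (fun s hs => by rw [max_eq_left hs]) ht
      · exact (J.intervalIntegral_comp_comm (hF.intervalIntegrable 0 t)).symm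
    rw [h4]
    exact (ι.intervalIntegral_comp_comm (hg0.intervalIntegrable 0 t)).symm
  have hL2 : ∀ t, 0 ≤ t → S (e.symm (U t)) = ∫ s in (0 : ℝ)..t, v (max s 0) :=
    fun t ht => by rw [← hS, e.apply_symm_apply, hjv t ht]
  have hHneg : ∀ t, 0 ≤ t → T (S (e.symm (U t))) =
      ∫ s in (0 : ℝ)..t, ∫ r in (0 : ℝ)..s, g r := fun t ht => by
    rw [hL2 t ht, hT]
    have h4 := (ι.comp J).intervalIntegral_comp_comm (hVc.intervalIntegrable (μ := volume) 0 t)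
    refine h4.symm.trans (integral_congr_of_nonneg (fun s hs => ?_) ht)
    rw [max_eq_left hs]
    exact hJv s hs
  have hU0 : U 0 = 0 := by simpa using h3 0 le_rfl
  have hv0 : v 0 = 0 := by
    have h4 := h2 0 le_rfl
    simp only [intervalIntegral.integral_same, neg_zero, map_zero, add_zero] at h4
    exact adjoint_injective_of_denseRange hdense (by simpa using h4)
  have huniq : UniqueDiffOn ℝ (Ici (0 : ℝ)) := uniqueDiffOn_Ici 0
  have huc : ContinuousOn (fun t => e.symm (U t)) (Ici 0) :=
    e.symm.continuous.comp_continuousOn hU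
  have hsol : IsDualWaveSolution S T A f fun t => e.symm (U t) :=
    { contDiffOn_dual := (contDiff_two_integral_integral hg).contDiffOn.congr hHneg
      contDiffOn_mid := (contDiff_one_integral hVc).contDiffOn.congr hL2
      continuousOn := huc
      wave_eq := fun t ht => by
        rw [iteratedDerivWithin_congr (s := Ici 0) hHneg ht,
          iteratedDerivWithin_eq_iteratedDeriv huniq
          (contDiff_two_integral_integral hg).contDiffAt ht,
          iteratedDeriv_two_integral_integral hg, hA,
          hT, ← map_add]
        simp only [g, max_eq_left ht, e.apply_symm_apply]
        rfl
      initial_value := by simp only [hU0, map_zero]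
      initial_velocity := by
        have h4 := (hVc.integral_hasStrictDerivAt 0 0).hasDerivAt.hasDerivWithinAt (s := Ici 0)
        rw [max_self, hv0] at h4
        exact (h4.congr hL2 (hL2 0 le_rfl)).derivWithin (huniq 0 self_mem_Ici) }
  refine ⟨fun t => e.symm (U t), hsol, fun v hv t ht => hv.unique hj hdense hS hT hA hf hsol ht,
    fun t ht => ?_, ?_⟩
  · rw [e.apply_symm_apply]
    exact (h3 t ht).trans_eq (integral_congr_of_nonneg (fun s hs => by rw [hmax s hs]) ht)
  · -- the Laplacian of the primitive of `u` is the velocity minus the primitive of `f`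
    have hw : ∀ t, 0 ≤ t → A (∫ s in (0 : ℝ)..t, e.symm (U s)) =
        T (v t - ∫ s in (0 : ℝ)..t, f (max s 0)) := fun t ht => by
      rw [hA, hT, map_sub]
      congr 1
      have h4 : e (∫ s in (0 : ℝ)..t, e.symm (U s)) = ∫ s in (0 : ℝ)..t, U s := by
        have h5 := (e : V →L[ℝ] W).intervalIntegral_comp_comm
          (intervalIntegrable_of_continuousOn_Ici huc ht)
        refine h5.symm.trans (intervalIntegral.integral_congr fun s _ => ?_)
        exact e.apply_symm_apply (U s)
      rw [h4, h2 t ht]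
      abel
    refine ⟨fun t => ∫ s in (0 : ℝ)..(max t 0), e.symm (U s),
      fun t => v (max t 0) - ∫ s in (0 : ℝ)..(max t 0), f (max s 0), ?_, ?_,
      fun t => hw _ (le_max_right t 0), fun t ht => ?_⟩
    · have h5 := ((contDiff_one_integral (continuous_comp_max huc)).continuous).comp
        (show Continuous fun t : ℝ => max t 0 by fun_prop)
      refine h5.congr fun t => integral_congr_of_nonneg (fun s hs => ?_) (le_max_right t 0)
      rw [max_eq_left hs]
    · exact hVc.sub (((contDiff_one_integral hF).continuous).comp
        (show Continuous fun t : ℝ => max t 0 by fun_prop))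
    · have h5 := S.intervalIntegral_comp_comm (intervalIntegrable_of_continuousOn_Ici huc ht)
      refine Eq.trans ?_ h5.symm
      simp only [max_eq_left ht]

end DualWave

/-! ### The Dirichlet problem for the wave equation -/

section DualWave

variable {V G H : Type*} [NormedAddCommGroup V] [NormedSpace ℝ V] [CompleteSpace V]
  [NormedAddCommGroup G] [InnerProductSpace ℝ G] [CompleteSpace G]
  [NormedAddCommGroup H] [InnerProductSpace ℝ H] [CompleteSpace H]

/-- Existence, uniqueness and energy estimate for the wave equation of a symmetric form
`(∇u, ∇v)`, under a Poincaré inequality. The gradients form a closed subspace of `G`, which serves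
as the Hilbert space identified with `V`. -/
theorem exists_dualWaveSolution_of_poincare {S : V →L[ℝ] H} {grad : V →L[ℝ] G}
    {T : H → StrongDual ℝ V} {A : V → StrongDual ℝ V}
    (hinj : Function.Injective S) (hdense : DenseRange S)
    (hnorm : ∀ u, ‖u‖ ^ 2 = ‖S u‖ ^ 2 + ‖grad u‖ ^ 2)
    (hpoincare : ∃ C : ℝ, 0 ≤ C ∧ ∀ u, ‖S u‖ ≤ C * ‖grad u‖)
    (hT : ∀ g v, T g v = inner ℝ g (S v)) (hA : ∀ u v, A u v = -inner ℝ (grad u) (grad v))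
    {f : ℝ → H} (hf : ContinuousOn f (Ici 0)) :
    ∃ u : ℝ → V, IsDualWaveSolution S T A f u ∧
      (∀ v : ℝ → V, IsDualWaveSolution S T A f v → ∀ t : ℝ, 0 ≤ t → v t = u t) ∧
      (∀ t : ℝ, 0 ≤ t → ‖grad (u t)‖ ≤ ∫ τ in (0 : ℝ)..t, ‖f τ‖) ∧
      ∃ (w : ℝ → V) (z : ℝ → H), Continuous w ∧ Continuous z ∧ (∀ t, A (w t) = T (z t)) ∧
        ∀ t : ℝ, 0 ≤ t → S (w t) = ∫ τ in (0 : ℝ)..t, S (u τ) := by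
  obtain ⟨C, hC0, hC⟩ := hpoincare
  have h : ∀ u : V, ‖u‖ ≤ (C + 1) * ‖grad u‖ := fun u => by
    refine abs_le_of_sq_le_sq' ?_ (by positivity) |>.2
    rw [hnorm]
    have h1 := pow_le_pow_left₀ (norm_nonneg _) (hC u) 2
    nlinarith [sq_nonneg ‖grad u‖]
  have ha : AntilipschitzWith (C + 1).toNNReal grad :=
    AddMonoidHomClass.antilipschitz_of_bound _ fun u => by
      rw [Real.coe_toNNReal _ (by positivity)]; exact h u
  have hclosed : IsClosed (range grad) := ha.isClosed_range grad.uniformContinuous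
  have : CompleteSpace grad.range := hclosed.completeSpace_coe
  let e : V ≃L[ℝ] grad.range := grad.equivRange ha.injective hclosed
  have he : ∀ u v, inner ℝ (e u) (e v) = inner ℝ (grad u) (grad v) := fun u v => rfl
  let j : grad.range →L[ℝ] H := S.comp (e.symm : grad.range →L[ℝ] V)
  have hj : ∀ u, j (e u) = S u := fun u => by simp [j]
  refine exists_dualWaveSolution (e := e) (j := j) (hinj.comp e.symm.injective)
    (hdense.comp e.symm.surjective.denseRange S.continuous) hj (fun g => ?_) (fun u => ?_) hf
  · ext v
    rw [hT, rieszDual_apply, ContinuousLinearMap.adjoint_inner_left, hj]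
  · ext v
    rw [hA, rieszDual_apply, inner_neg_left, he]

end DualWave

section WeakSolution

variable {d : ℕ} {Ω : Opens (Euc d)}

/-- The norm structure of `H¹₀(Ω)` as a subspace of `H¹(Ω)`, recorded because instance search
through the nested subspaces is slow. -/
instance H10.normedAddCommGroup : NormedAddCommGroup (H10 Ω) := inferInstance

set_option synthInstance.maxHeartbeats 200000 in
/-- The companion of `H10.normedAddCommGroup`. -/
instance H10.normedSpace :
    @NormedSpace ℝ (H10 Ω) _ H10.normedAddCommGroup.toSeminormedAddCommGroup := inferInstance

theorem isWeakSolution_iff {f : ℝ → L2 Ω} {u : ℝ → H10 Ω} :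
    IsWeakSolution Ω f u ↔
      IsDualWaveSolution (V := H10 Ω) (H := L2 Ω) (H10.toL2 Ω) (L2.toHneg1 Ω) (laplacian Ω) f u :=
  ⟨fun h => ⟨h.1, h.2, h.3, h.4, h.5, h.6⟩, fun h => ⟨h.1, h.2, h.3, h.4, h.5, h.6⟩⟩

/-- The wave equation in a bounded open set; `Δw` for the primitive `w` of `u` is `u̇` minus the
primitive of `f`, which is where the continuity in `D(Δ)` comes from. -/
theorem exists_weakSolution (hd : 0 < d) (hΩ : Bornology.IsBounded (Ω : Set (Euc d)))
    {f : ℝ → L2 Ω} (hf : ContinuousOn f (Ici 0)) :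
    ∃ u : ℝ → H10 Ω, IsWeakSolution Ω f u ∧
      (∀ v : ℝ → H10 Ω, IsWeakSolution Ω f v → ∀ t : ℝ, 0 ≤ t → v t = u t) ∧
      (∀ t : ℝ, 0 ≤ t → ‖H10.grad Ω (u t)‖ ≤ ∫ τ in (0 : ℝ)..t, ‖f τ‖) ∧
      ∃ w : ℝ → DomLaplacian Ω, Continuous w ∧
        ∀ t : ℝ, 0 ≤ t → DomLaplacian.toL2 Ω (w t) = ∫ τ in (0 : ℝ)..t, H10.toL2 Ω (u τ) := by
  obtain ⟨u, h1, h2, h3, w, z, hw, hz, hwz, hint⟩ :=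
    exists_dualWaveSolution_of_poincare (V := H10 Ω) (H := L2 Ω)
      (G := PiLp 2 (fun _ : Fin d => L2 Ω)) (S := H10.toL2 Ω) (grad := H10.grad Ω)
      (T := L2.toHneg1 Ω) (A := laplacian Ω) H10.toL2_injective H10.denseRange_toL2 H10.norm_sq
      (H10.exists_norm_toL2_le hd hΩ) (L2.toHneg1_apply Ω) (laplacian_apply Ω) hf
  refine ⟨u, isWeakSolution_iff.2 h1, fun v hv => h2 v (isWeakSolution_iff.1 hv), h3,
    fun t => ⟨WithLp.toLp 2 (w t, z t), hwz t⟩, ?_, hint⟩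
  exact Continuous.subtype_mk ((WithLp.prod_continuous_toLp 2 _ _).comp (hw.prodMk hz)) _

end WeakSolution

/-! ### Polynomials in L² and H¹ of a bounded open set -/

section Polynomials

variable {d : ℕ} {Ω : Opens (Euc d)}

theorem isFiniteMeasure_volume_restrict (hΩ : Bornology.IsBounded (Ω : Set (Euc d))) :
    IsFiniteMeasure (volume.restrict (Ω : Set (Euc d))) :=
  MeasureTheory.isFiniteMeasure_restrict.2 hΩ.measure_lt_top.ne

theorem exists_forall_norm_le_of_continuous (hΩ : Bornology.IsBounded (Ω : Set (Euc d)))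
    {g : Euc d → ℝ} (hg : Continuous g) : ∃ C, 0 ≤ C ∧ ∀ x ∈ (Ω : Set (Euc d)), ‖g x‖ ≤ C := by
  obtain ⟨C, hC⟩ := hΩ.isCompact_closure.exists_bound_of_continuousOn hg.continuousOn
  exact ⟨max C 0, le_max_right _ _, fun x hx => (hC x (subset_closure hx)).trans (le_max_left _ _)⟩

theorem memLp_of_continuous (hΩ : Bornology.IsBounded (Ω : Set (Euc d)))
    {g : Euc d → ℝ} (hg : Continuous g) : MemLp g 2 (volume.restrict (Ω : Set (Euc d))) := by
  have := isFiniteMeasure_volume_restrict hΩ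
  obtain ⟨C, -, hC⟩ := exists_forall_norm_le_of_continuous hΩ hg
  exact MemLp.of_bound hg.aestronglyMeasurable C
    ((ae_restrict_iff' Ω.isOpen.measurableSet).2 (ae_of_all _ hC))

theorem integrableOn_of_continuous (hΩ : Bornology.IsBounded (Ω : Set (Euc d)))
    {g : Euc d → ℝ} (hg : Continuous g) : Integrable g (volume.restrict (Ω : Set (Euc d))) := by
  have := isFiniteMeasure_volume_restrict hΩ
  exact (memLp_of_continuous hΩ hg).integrable (by norm_num)

/-- Bounded pointwise convergence on a bounded open set. -/
theorem tendsto_setIntegral_of_bounded (hΩ : Bornology.IsBounded (Ω : Set (Euc d)))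
    {g : ℕ → Euc d → ℝ} {g₀ : Euc d → ℝ} (hg : ∀ n, Continuous (g n)) {C : ℝ}
    (hC : ∀ n, ∀ x ∈ (Ω : Set (Euc d)), ‖g n x‖ ≤ C)
    (hlim : ∀ x ∈ (Ω : Set (Euc d)), Tendsto (fun n => g n x) atTop (𝓝 (g₀ x))) :
    Tendsto (fun n => ∫ x in (Ω : Set (Euc d)), g n x) atTop
      (𝓝 (∫ x in (Ω : Set (Euc d)), g₀ x)) := by
  have := isFiniteMeasure_volume_restrict hΩ
  refine tendsto_integral_of_dominated_convergence (fun _ => C)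
    (fun n => (hg n).aestronglyMeasurable) (integrable_const C) (fun n => ?_) ?_
  · exact (ae_restrict_iff' Ω.isOpen.measurableSet).2 (ae_of_all _ (hC n))
  · exact (ae_restrict_iff' Ω.isOpen.measurableSet).2 (ae_of_all _ hlim)

theorem norm_toLp_sub_sq {g h : Euc d → ℝ}
    (hg : MemLp g 2 (volume.restrict (Ω : Set (Euc d))))
    (hh : MemLp h 2 (volume.restrict (Ω : Set (Euc d)))) :
    ‖hg.toLp g - hh.toLp h‖ ^ 2 = ∫ x in (Ω : Set (Euc d)), (g x - h x) * (g x - h x) := by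
  rw [← MemLp.toLp_sub hg hh, ← real_inner_self_eq_norm_sq, L2.inner_toLp_toLp]
  rfl

theorem tendsto_toLp_of_bounded (hΩ : Bornology.IsBounded (Ω : Set (Euc d)))
    {g : ℕ → Euc d → ℝ} {g₀ : Euc d → ℝ} (hg : ∀ n, Continuous (g n)) (hg₀ : Continuous g₀) {C : ℝ}
    (hC : ∀ n, ∀ x ∈ (Ω : Set (Euc d)), ‖g n x‖ ≤ C)
    (hlim : ∀ x ∈ (Ω : Set (Euc d)), Tendsto (fun n => g n x) atTop (𝓝 (g₀ x)))
    (hgm : ∀ n, MemLp (g n) 2 (volume.restrict (Ω : Set (Euc d))))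
    (hgm₀ : MemLp g₀ 2 (volume.restrict (Ω : Set (Euc d)))) :
    Tendsto (fun n => (hgm n).toLp (g n)) atTop (𝓝 (hgm₀.toLp g₀)) := by
  rw [tendsto_iff_norm_sub_tendsto_zero]
  have h1 : Tendsto (fun n => ‖(hgm n).toLp (g n) - hgm₀.toLp g₀‖ ^ 2) atTop (𝓝 0) := by
    simp only [norm_toLp_sub_sq]
    have h2 := tendsto_setIntegral_of_bounded hΩ (g := fun n x => (g n x - g₀ x) * (g n x - g₀ x))
      (g₀ := fun _ => 0) (C := (C + C) * (C + C)) (fun n => by have := hg n; fun_prop)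
      (fun n x hx => ?_) (fun x hx => ?_)
    · simpa using h2
    · have h3 : ‖g₀ x‖ ≤ C :=
        le_of_tendsto (hlim x hx).norm (Eventually.of_forall fun n => hC n x hx)
      have h4 : ‖g n x - g₀ x‖ ≤ C + C := (norm_sub_le _ _).trans (add_le_add (hC n x hx) h3)
      rw [norm_mul]
      exact mul_le_mul h4 h4 (norm_nonneg _) ((norm_nonneg _).trans h4)
    · have h3 := (hlim x hx).sub_const (g₀ x)
      rw [sub_self] at h3
      simpa using h3.mul h3
  have h5 := h1.sqrt
  simpa [Real.sqrt_sq (norm_nonneg _)] using h5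

/-- The polynomial function on `ℝ^d` defined by a multivariate polynomial. -/
def polyFun (p : MvPolynomial (Fin d) ℝ) (x : Euc d) : ℝ := MvPolynomial.eval (fun i => x i) p

theorem polyFun_add (p q : MvPolynomial (Fin d) ℝ) (x : Euc d) :
    polyFun (p + q) x = polyFun p x + polyFun q x := map_add _ _ _

theorem polyFun_sub (p q : MvPolynomial (Fin d) ℝ) (x : Euc d) :
    polyFun (p - q) x = polyFun p x - polyFun q x := map_sub _ _ _

theorem polyFun_mul (p q : MvPolynomial (Fin d) ℝ) (x : Euc d) :
    polyFun (p * q) x = polyFun p x * polyFun q x := map_mul _ _ _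

theorem polyFun_sum {ι : Type*} (s : Finset ι) (p : ι → MvPolynomial (Fin d) ℝ) (x : Euc d) :
    polyFun (∑ i ∈ s, p i) x = ∑ i ∈ s, polyFun (p i) x := map_sum _ _ _

theorem polyFun_C (c : ℝ) (x : Euc d) : polyFun (MvPolynomial.C c) x = c :=
  MvPolynomial.eval_C _

theorem polyFun_X (i : Fin d) (x : Euc d) : polyFun (MvPolynomial.X i) x = x i :=
  MvPolynomial.eval_X _

theorem contDiff_polyFun (p : MvPolynomial (Fin d) ℝ) {n : WithTop ℕ∞} :
    ContDiff ℝ n (polyFun p) := by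
  induction p using MvPolynomial.induction_on with
  | C c =>
    rw [show polyFun (MvPolynomial.C c : MvPolynomial (Fin d) ℝ) = fun _ => c from
      funext (polyFun_C c)]
    exact contDiff_const
  | add p q hp hq =>
    rw [show polyFun (p + q) = fun x => polyFun p x + polyFun q x from funext (polyFun_add p q)]
    exact hp.add hq
  | mul_X p i hp =>
    rw [show polyFun (p * MvPolynomial.X i) = fun x => polyFun p x * x i from
      funext fun x => by rw [polyFun_mul, polyFun_X]]
    exact hp.mul (contDiff_coord i)

theorem continuous_polyFun (p : MvPolynomial (Fin d) ℝ) : Continuous (polyFun p) :=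
  (contDiff_polyFun p (n := 0)).continuous

theorem differentiable_polyFun (p : MvPolynomial (Fin d) ℝ) : Differentiable ℝ (polyFun p) :=
  (contDiff_polyFun p (n := 1)).differentiable (by simp)

theorem partialDeriv_polyFun (p : MvPolynomial (Fin d) ℝ) (i : Fin d) :
    partialDeriv i (polyFun p) = polyFun (MvPolynomial.pderiv i p) := by
  induction p using MvPolynomial.induction_on with
  | C c =>
    rw [show polyFun (MvPolynomial.C c : MvPolynomial (Fin d) ℝ) = fun _ => c from
      funext (polyFun_C c)]
    ext x
    simp [partialDeriv, polyFun]
  | add p q hp hq =>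
    ext x
    rw [show polyFun (p + q) = fun x => polyFun p x + polyFun q x from funext (polyFun_add p q),
      map_add, polyFun_add, ← hp, ← hq, partialDeriv, fderiv_fun_add (differentiable_polyFun p x)
      (differentiable_polyFun q x)]
    rfl
  | mul_X p j hp =>
    ext x
    rw [show polyFun (p * MvPolynomial.X j) = fun x => polyFun p x * x j from
      funext fun x => by rw [polyFun_mul, polyFun_X],
      partialDeriv_mul (differentiable_polyFun p x)
        ((contDiff_coord j (n := 1)).differentiable (by simp) x), partialDeriv_coord, hp,
      Derivation.leibniz, MvPolynomial.pderiv_X, smul_eq_mul, smul_eq_mul, polyFun_add,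
      polyFun_mul, polyFun_mul, polyFun_X]
    by_cases h : j = i
    · subst h
      simp [polyFun, mul_comm]
    · simp [h, polyFun, mul_comm]

/-- The class of a polynomial in `L²(Ω)`, for bounded `Ω`. -/
def polyL2 (hΩ : Bornology.IsBounded (Ω : Set (Euc d))) : MvPolynomial (Fin d) ℝ →ₗ[ℝ] L2 Ω where
  toFun p := (memLp_of_continuous hΩ (continuous_polyFun p)).toLp (polyFun p)
  map_add' p q := by
    rw [← MemLp.toLp_add]
    exact MemLp.toLp_congr _ _ (ae_of_all _ (polyFun_add p q))
  map_smul' c p := by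
    rw [RingHom.id_apply, ← MemLp.toLp_const_smul]
    refine MemLp.toLp_congr _ _ (ae_of_all _ fun x => ?_)
    simp [polyFun, MvPolynomial.smul_eval]

theorem polyL2_apply (hΩ : Bornology.IsBounded (Ω : Set (Euc d))) (p : MvPolynomial (Fin d) ℝ) :
    polyL2 hΩ p = (memLp_of_continuous hΩ (continuous_polyFun p)).toLp (polyFun p) := rfl

theorem norm_polyL2_sq (hΩ : Bornology.IsBounded (Ω : Set (Euc d))) (p : MvPolynomial (Fin d) ℝ) :
    ‖polyL2 hΩ p‖ ^ 2 = ∫ x in (Ω : Set (Euc d)), polyFun (p * p) x := by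
  rw [← real_inner_self_eq_norm_sq, polyL2_apply, L2.inner_toLp_toLp]
  simp only [polyFun_mul]

theorem isWeakDeriv_polyL2 (hΩ : Bornology.IsBounded (Ω : Set (Euc d)))
    (p : MvPolynomial (Fin d) ℝ) (i : Fin d) :
    IsWeakDeriv Ω i (polyL2 hΩ p) (polyL2 hΩ (MvPolynomial.pderiv i p)) := by
  have h := isWeakDeriv_toLp (Ω := Ω) (contDiff_polyFun p) (i := i)
    (memLp_of_continuous hΩ (continuous_polyFun p))
    (by rw [partialDeriv_polyFun]; exact memLp_of_continuous hΩ (continuous_polyFun _))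
  simp only [partialDeriv_polyFun] at h
  exact h

/-- A polynomial as an element of `H¹(Ω)`, for bounded `Ω`. -/
def polyH1 (hΩ : Bornology.IsBounded (Ω : Set (Euc d))) (p : MvPolynomial (Fin d) ℝ) : H1 Ω :=
  ⟨WithLp.toLp 2 (polyL2 hΩ p, WithLp.toLp 2 fun i => polyL2 hΩ (MvPolynomial.pderiv i p)),
    fun i => isWeakDeriv_polyL2 hΩ p i⟩

/-- Polynomials are dense in `L²(Ω)` for bounded `Ω`, by the Stone–Weierstrass theorem. -/
theorem denseRange_polyL2 (hΩ : Bornology.IsBounded (Ω : Set (Euc d))) :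
    DenseRange (polyL2 hΩ) := by
  let K : Set (Euc d) := closure Ω
  have hK : IsCompact K := hΩ.isCompact_closure
  have : CompactSpace K := isCompact_iff_compactSpace.1 hK
  let coord : Fin d → C(K, ℝ) := fun i => ⟨fun x => x.1 i, by fun_prop⟩
  let a : MvPolynomial (Fin d) ℝ →ₐ[ℝ] C(K, ℝ) := MvPolynomial.aeval coord
  have ha : ∀ p (x : K), a p x = polyFun p x := fun p x => by
    induction p using MvPolynomial.induction_on with
    | C c => simp [a, polyFun_C]
    | add p q hp hq => rw [map_add, polyFun_add, ← hp, ← hq]; rfl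
    | mul_X p i hp =>
      rw [map_mul, polyFun_mul, ← hp, polyFun_X, ContinuousMap.mul_apply]
      simp [a, coord]
  have hsep : a.range.SeparatesPoints := by
    intro x y hxy
    obtain ⟨i, hi⟩ : ∃ i, x.1 i ≠ y.1 i := by
      by_contra! h
      exact hxy (Subtype.ext (PiLp.ext h))
    refine ⟨_, ⟨a (MvPolynomial.X i), ⟨MvPolynomial.X i, rfl⟩, rfl⟩, ?_⟩
    simpa [ha, polyFun_X] using hi
  have hSW := ContinuousMap.subalgebra_topologicalClosure_eq_top_of_separatesPoints a.range hsep
  have hdense : closure (range (polyL2 hΩ)) = univ := by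
    refine eq_univ_of_univ_subset ?_
    have h1 : range (H10.toL2 Ω) ⊆ closure (range (polyL2 hΩ)) := by
      rintro _ ⟨u, rfl⟩
      refine H10.induction_closed (P := fun u => H10.toL2 Ω u ∈ closure (range (polyL2 hΩ)))
        (isClosed_closure.preimage (H10.toL2 Ω).continuous) (fun φ => ?_) u
      rw [H10.toL2_testH10, mem_closure_iff_seq_limit]
      let φK : C(K, ℝ) := ⟨fun x => φ x.1, φ.continuous.comp continuous_subtype_val⟩
      have h2 : φK ∈ closure (a.range : Set C(K, ℝ)) := by
        have : φK ∈ a.range.topologicalClosure := by rw [hSW]; trivial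
        exact this
      obtain ⟨s, hs, hlim⟩ := mem_closure_iff_seq_limit.1 h2
      choose p hp using hs
      refine ⟨fun n => polyL2 hΩ (p n), fun n => ⟨p n, rfl⟩, ?_⟩
      obtain ⟨C, hC⟩ := (Metric.isBounded_range_of_tendsto s hlim).exists_norm_le
      have hps : ∀ n (x : K), polyFun (p n) x = s n x := fun n x => by
        rw [← ha, ← hp n]; rfl
      refine tendsto_toLp_of_bounded hΩ (fun n => continuous_polyFun _) φ.continuous (C := C)
        (fun n x hx => ?_) (fun x hx => ?_)
        (fun n => memLp_of_continuous hΩ (continuous_polyFun _)) (TestFunction.memLp Ω φ)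
      · rw [hps n ⟨x, subset_closure hx⟩]
        exact (ContinuousMap.norm_coe_le_norm _ _).trans (hC _ ⟨n, rfl⟩)
      · have h3 := ((continuous_eval_const (F := C(K, ℝ)) (⟨x, subset_closure hx⟩ : K)).tendsto
          φK).comp hlim
        refine h3.congr fun n => ?_
        exact (hps n ⟨x, subset_closure hx⟩).symm
    rw [← H10.denseRange_toL2.closure_range]
    exact closure_minimal h1 isClosed_closure
  exact dense_iff_closure_eq.2 hdense

end Polynomials

/-! ### The Laplacian and the Hessian of polynomials that vanish on a sphere -/

section PolynomialLaplacian

open MvPolynomial in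
theorem pderiv_comm {σ : Type*} (i j : σ) (p : MvPolynomial σ ℝ) :
    pderiv i (pderiv j p) = pderiv j (pderiv i p) := by
  ext m
  simp only [coeff_pderiv]
  rw [add_right_comm]
  by_cases h : i = j
  · subst h; rfl
  · have h' : j ≠ i := Ne.symm h
    simp [h, h']
    ring

open MvPolynomial in
theorem totalDegree_pderiv_le {σ : Type*} {p : MvPolynomial σ ℝ} {k : ℕ}
    (hp : p.totalDegree ≤ k + 1) (i : σ) : (pderiv i p).totalDegree ≤ k := by
  refine Finset.sup_le fun m hm => ?_
  rw [mem_support_iff, coeff_pderiv] at hm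
  have h1 : m + Finsupp.single i 1 ∈ p.support := mem_support_iff.2 (left_ne_zero_of_mul hm)
  have h2 := (le_totalDegree h1).trans hp
  rw [Finsupp.sum_add_index' (by simp) (by simp), Finsupp.sum_single_index rfl] at h2
  omega

variable {d : ℕ} {Ω : Opens (Euc d)}

/-- The Laplacian of a polynomial. -/
def polyLap : MvPolynomial (Fin d) ℝ →ₗ[ℝ] MvPolynomial (Fin d) ℝ :=
  ∑ i, (MvPolynomial.pderiv i).toLinearMap ∘ₗ (MvPolynomial.pderiv i).toLinearMap

theorem polyLap_apply (p : MvPolynomial (Fin d) ℝ) :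
    polyLap p = ∑ i, MvPolynomial.pderiv i (MvPolynomial.pderiv i p) := by
  simp [polyLap]

theorem totalDegree_polyLap_le {p : MvPolynomial (Fin d) ℝ} {k : ℕ}
    (hp : p.totalDegree ≤ k + 2) : (polyLap p).totalDegree ≤ k := by
  rw [polyLap_apply]
  refine MvPolynomial.totalDegree_finsetSum_le fun i _ => ?_
  exact totalDegree_pderiv_le (totalDegree_pderiv_le hp i) i

/-- The vector field `(D²u) ∇u - (Δu) ∇u`. -/
def hessianField (u : MvPolynomial (Fin d) ℝ) (i : Fin d) : MvPolynomial (Fin d) ℝ :=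
  ∑ j, MvPolynomial.pderiv i (MvPolynomial.pderiv j u) * MvPolynomial.pderiv j u -
    polyLap u * MvPolynomial.pderiv i u

theorem div_hessianField (u : MvPolynomial (Fin d) ℝ) :
    ∑ i, MvPolynomial.pderiv i (hessianField u i) =
      ∑ i, ∑ j, MvPolynomial.pderiv i (MvPolynomial.pderiv j u) *
        MvPolynomial.pderiv i (MvPolynomial.pderiv j u) - polyLap u * polyLap u := by
  have h1 : ∀ i, MvPolynomial.pderiv i (hessianField u i) =
      ∑ j, (MvPolynomial.pderiv i (MvPolynomial.pderiv i (MvPolynomial.pderiv j u)) *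
        MvPolynomial.pderiv j u +
      MvPolynomial.pderiv i (MvPolynomial.pderiv j u) *
        MvPolynomial.pderiv i (MvPolynomial.pderiv j u)) -
      (MvPolynomial.pderiv i (polyLap u) * MvPolynomial.pderiv i u +
        polyLap u * MvPolynomial.pderiv i (MvPolynomial.pderiv i u)) := fun i => by
    simp only [hessianField, map_sub, map_sum, MvPolynomial.pderiv_mul]
  have h2 : ∑ i, ∑ j, MvPolynomial.pderiv i (MvPolynomial.pderiv i (MvPolynomial.pderiv j u)) *
      MvPolynomial.pderiv j u = ∑ j, MvPolynomial.pderiv j (polyLap u) *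
        MvPolynomial.pderiv j u := by
    rw [Finset.sum_comm]
    refine Finset.sum_congr rfl fun j _ => ?_
    rw [← Finset.sum_mul, polyLap_apply, map_sum]
    congr 1
    refine Finset.sum_congr rfl fun i _ => ?_
    rw [pderiv_comm i j u, pderiv_comm i j]
  simp only [h1, Finset.sum_sub_distrib, Finset.sum_add_distrib, h2]
  rw [← Finset.mul_sum, ← polyLap_apply]
  ring

/-- The polynomial `ρ² - |x|²`, a defining function of the ball of radius `ρ`. -/
def ballPoly (d : ℕ) (ρ : ℝ) : MvPolynomial (Fin d) ℝ :=
  MvPolynomial.C (ρ ^ 2) - ∑ i, MvPolynomial.X i * MvPolynomial.X i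

theorem polyFun_ballPoly (ρ : ℝ) (x : Euc d) : polyFun (ballPoly d ρ) x = ρ ^ 2 - ‖x‖ ^ 2 := by
  rw [ballPoly, polyFun_sub, polyFun_C, polyFun_sum, EuclideanSpace.norm_sq_eq]
  simp [polyFun_mul, polyFun_X, sq]

theorem polyFun_ballPoly_pos {ρ : ℝ} {x : Euc d} (hx : x ∈ Metric.ball (0 : Euc d) ρ) :
    0 < polyFun (ballPoly d ρ) x := by
  rw [mem_ball_zero_iff] at hx
  rw [polyFun_ballPoly]
  nlinarith [norm_nonneg x]

theorem pderiv_ballPoly (ρ : ℝ) (i : Fin d) :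
    MvPolynomial.pderiv i (ballPoly d ρ) = -2 * MvPolynomial.X i := by
  simp only [ballPoly, map_sub, MvPolynomial.pderiv_C, map_sum, MvPolynomial.pderiv_mul,
    MvPolynomial.pderiv_X]
  rw [Finset.sum_eq_single i (fun j _ hj => by simp [hj]) (by simp)]
  simp only [Pi.single_eq_same]
  ring

theorem totalDegree_ballPoly_le (ρ : ℝ) : (ballPoly d ρ).totalDegree ≤ 2 := by
  refine (MvPolynomial.totalDegree_sub _ _).trans
    (max_le (by rw [MvPolynomial.totalDegree_C]; exact Nat.zero_le _) ?_)
  refine MvPolynomial.totalDegree_finsetSum_le fun i _ => ?_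
  refine (MvPolynomial.totalDegree_mul _ _).trans ?_
  simp

/-- The boundary term of the integration by parts below, for the leading parts of the gradient and
of the Hessian of `η q` on the sphere `η = 0`. -/
theorem sphere_identity {A : Type*} [CommRing A] (a b : Fin d → A) (q : A) :
    ∑ i, (-2 * a i) * (∑ j, ((-2 * (if i = j then 1 else 0) * q) - 2 * a i * b j - 2 * a j * b i) *
        (-2 * a j * q) - (∑ k, (-2 * q - 2 * a k * b k - 2 * a k * b k)) * (-2 * a i * q)) =
      8 * (d - 1) * (q * q * ∑ i, a i * a i) := by
  have h1 : ∀ i, ∑ j, ((-2 * (if i = j then 1 else 0) * q) - 2 * a i * b j - 2 * a j * b i) *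
      (-2 * a j * q) = 4 * q * q * a i + 4 * q * a i * (∑ j, a j * b j) +
        4 * q * b i * ∑ j, a j * a j := fun i => by
    have h2 : ∀ j, ((-2 * (if i = j then 1 else 0) * q) - 2 * a i * b j - 2 * a j * b i) *
        (-2 * a j * q) = (if i = j then 4 * q * q * a j else 0) + 4 * q * a i * (a j * b j) +
          4 * q * b i * (a j * a j) := fun j => by
      split_ifs <;> ring
    simp only [h2, Finset.sum_add_distrib, ← Finset.mul_sum]
    simp
  have h3 : ∑ k, (-2 * q - 2 * a k * b k - 2 * a k * b k) = -2 * d * q - 4 * ∑ k, a k * b k := by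
    have h4 : ∀ k, -2 * q - 2 * a k * b k - 2 * a k * b k = -2 * q - 4 * (a k * b k) :=
      fun k => by ring
    simp only [h4, Finset.sum_sub_distrib, ← Finset.mul_sum]
    simp
    ring
  simp only [h1, h3]
  generalize ht : ∑ j, a j * b j = t
  generalize hs : ∑ j, a j * a j = s
  have h5 : ∀ i, (-2 * a i) * (4 * q * q * a i + 4 * q * a i * t + 4 * q * b i * s -
      (-2 * d * q - 4 * t) * (-2 * a i * q)) =
      (-8 * q * q + 8 * d * q * q + 8 * q * t) * (a i * a i) - 8 * q * s * (a i * b i) :=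
    fun i => by ring
  simp only [h5, Finset.sum_sub_distrib, ← Finset.mul_sum, ht, hs]
  ring

open MvPolynomial in
/-- For `u = η q` with `η = ρ² - |x|²`, the component of `(D²u) ∇u - (Δu) ∇u` along the inner normal
`∇η` equals `8 (d - 1) |x|² q²` on the sphere `η = 0`, hence is nonnegative there. The factor
`d - 1` reflects the mean curvature of the sphere. Working modulo the ideal of `η` restricts to the
sphere. -/
theorem exists_normal_hessianField (ρ : ℝ) (q : MvPolynomial (Fin d) ℝ) :
    ∃ P, ∑ i, pderiv i (ballPoly d ρ) * hessianField (ballPoly d ρ * q) i =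
      8 * (d - 1) * (q * q * ∑ i, X i * X i) + ballPoly d ρ * P := by
  let η := ballPoly d ρ
  have hu : ∀ j, pderiv j (η * q) = -2 * X j * q + η * pderiv j q := fun j => by
    rw [pderiv_mul, pderiv_ballPoly]
  have hη : ∀ j, pderiv j η = -2 * X j := pderiv_ballPoly ρ
  have hU : ∀ i j, pderiv i (pderiv j (η * q)) =
      (-2 * (if i = j then 1 else 0) * q - 2 * X i * pderiv j q - 2 * X j * pderiv i q) +
        η * pderiv i (pderiv j q) := fun i j => by
    rw [hu, map_add, pderiv_mul, pderiv_mul, pderiv_mul, hη, pderiv_X,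
      show pderiv i (-2 : MvPolynomial (Fin d) ℝ) = 0 by
        rw [map_neg, show (2 : MvPolynomial (Fin d) ℝ) = C 2 from (map_ofNat C 2).symm,
          pderiv_C, neg_zero]]
    by_cases h : i = j
    · subst h
      simp only [Pi.single_eq_same, if_true]
      ring
    · simp only [h, if_false, Pi.single_apply, Ne.symm h]
      ring
  let φ := Ideal.Quotient.mk (Ideal.span {η})
  have hφ : φ η = 0 := Ideal.Quotient.eq_zero_iff_mem.2 (Ideal.mem_span_singleton_self η)
  have hmain : φ (∑ i, pderiv i η * hessianField (η * q) i) =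
      φ (8 * (d - 1) * (q * q * ∑ i, X i * X i)) := by
    have h1 := sphere_identity (fun i => φ (X i)) (fun i => φ (pderiv i q)) (φ q)
    have h2 : φ (8 * (d - 1) * (q * q * ∑ i, X i * X i)) =
        8 * (d - 1) * (φ q * φ q * ∑ i, φ (X i) * φ (X i)) := by
      simp only [map_mul, map_sub, map_sum, map_natCast, map_one, map_ofNat]
    rw [h2, ← h1, map_sum]
    refine Finset.sum_congr rfl fun i _ => ?_
    rw [map_mul, hη, hessianField, polyLap_apply]
    simp only [hU]
    simp only [hu, map_sub, map_sum, map_mul, map_add, hφ, zero_mul, add_zero, map_neg,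
      map_ofNat, apply_ite φ, map_one, map_zero, if_true, mul_one]
  obtain ⟨P, hP⟩ := Ideal.mem_span_singleton.1 (Ideal.Quotient.eq.1 hmain)
  exact ⟨P, by rw [← hP]; ring⟩

end PolynomialLaplacian

/-! ### The divergence theorem and the a priori estimate on a ball -/

section BallEstimate

/-- A smooth nondecreasing function that vanishes on `(-∞, 1]` and equals `1` on `[2, ∞)`. -/
def step (s : ℝ) : ℝ := Real.smoothTransition (s - 1)

theorem contDiff_step {n : ℕ∞} : ContDiff ℝ n step :=
  Real.smoothTransition.contDiff.comp (contDiff_id.sub contDiff_const)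

theorem step_nonneg (s : ℝ) : 0 ≤ step s := Real.smoothTransition.nonneg _

theorem step_le_one (s : ℝ) : step s ≤ 1 := Real.smoothTransition.le_one _

theorem step_of_le_one {s : ℝ} (h : s ≤ 1) : step s = 0 :=
  Real.smoothTransition.zero_of_nonpos (by linarith)

theorem step_of_two_le {s : ℝ} (h : 2 ≤ s) : step s = 1 :=
  Real.smoothTransition.one_of_one_le (by linarith)

theorem deriv_step_nonneg (s : ℝ) : 0 ≤ deriv step s :=
  (Real.smoothTransition.monotone.comp fun _ _ h => sub_le_sub_right h 1 :
    Monotone step).deriv_nonneg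

theorem deriv_step_of_two_lt {s : ℝ} (h : 2 < s) : deriv step s = 0 := by
  have : step =ᶠ[𝓝 s] fun _ => 1 := by
    filter_upwards [lt_mem_nhds h] with r hr
    exact step_of_two_le hr.le
  rw [this.deriv_eq, deriv_const]

theorem continuous_deriv_step : Continuous (deriv step) :=
  (contDiff_step (n := 1)).continuous_deriv (by simp)

theorem exists_mul_deriv_step_le : ∃ K, 0 ≤ K ∧ ∀ s, 0 ≤ s → |s * deriv step s| ≤ K := by
  obtain ⟨K, hK⟩ := isCompact_Icc.exists_bound_of_continuousOn (s := Icc (0 : ℝ) 2)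
    (f := fun s => s * deriv step s) (continuous_id.mul continuous_deriv_step).continuousOn
  refine ⟨max K 0, le_max_right _ _, fun s hs => ?_⟩
  by_cases h : s ≤ 2
  · exact (hK s ⟨hs, h⟩).trans (le_max_left _ _)
  · rw [deriv_step_of_two_lt (not_le.1 h)]
    simp

variable {d : ℕ} {Ω : Opens (Euc d)} {ρ : ℝ}

/-- The cutoff functions `χ(n (ρ² - |x|²))` of the ball of radius `ρ`. -/
def ballCutoff (ρ : ℝ) (n : ℕ) (x : Euc d) : ℝ := step (n * polyFun (ballPoly d ρ) x)

theorem contDiff_ballCutoff (n : ℕ) {k : ℕ∞} :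
    ContDiff ℝ k (ballCutoff (d := d) ρ n) :=
  contDiff_step.comp (contDiff_const.mul (contDiff_polyFun _))

theorem partialDeriv_ballCutoff (n : ℕ) (i : Fin d) (x : Euc d) :
    partialDeriv i (ballCutoff ρ n) x = n * deriv step (n * polyFun (ballPoly d ρ) x) *
      polyFun (MvPolynomial.pderiv i (ballPoly d ρ)) x := by
  have h1 : HasFDerivAt (fun x => (n : ℝ) * polyFun (ballPoly d ρ) x)
      ((n : ℝ) • fderiv ℝ (polyFun (ballPoly d ρ)) x) x :=
    (differentiable_polyFun _ x).hasFDerivAt.const_mul _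
  have h2 : HasDerivAt step (deriv step (n * polyFun (ballPoly d ρ) x))
      (n * polyFun (ballPoly d ρ) x) :=
    ((contDiff_step (n := 1)).differentiable (by simp) _).hasDerivAt
  have h3 := h2.comp_hasFDerivAt x h1
  rw [partialDeriv,
    show ballCutoff ρ n = step ∘ fun x => (n : ℝ) * polyFun (ballPoly d ρ) x from rfl,
    h3.fderiv, ← partialDeriv_polyFun]
  simp only [_root_.smul_apply, smul_eq_mul, partialDeriv]
  ring

theorem tsupport_ballCutoff_subset (n : ℕ) :
    tsupport (ballCutoff (d := d) ρ n) ⊆ {x | 1 ≤ n * polyFun (ballPoly d ρ) x} := by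
  refine closure_minimal (fun x hx => ?_)
    (isClosed_le continuous_const (continuous_const.mul (continuous_polyFun _)))
  by_contra h
  exact hx (step_of_le_one (not_le.1 h).le)

theorem tsupport_ballCutoff_subset_ball (hρ : 0 < ρ) (n : ℕ) :
    tsupport (ballCutoff (d := d) ρ n) ⊆ Metric.ball 0 ρ := by
  intro x hx
  have h1 : 1 ≤ (n : ℝ) * polyFun (ballPoly d ρ) x := tsupport_ballCutoff_subset n hx
  have h2 : 0 < polyFun (ballPoly d ρ) x := by
    by_contra h
    have := mul_nonpos_of_nonneg_of_nonpos (Nat.cast_nonneg (α := ℝ) n) (not_lt.1 h)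
    linarith
  rw [polyFun_ballPoly] at h2
  rw [mem_ball_zero_iff]
  exact lt_of_pow_lt_pow_left₀ 2 hρ.le (by linarith)

theorem hasCompactSupport_ballCutoff (hρ : 0 < ρ) (n : ℕ) :
    HasCompactSupport (ballCutoff (d := d) ρ n) :=
  (isCompact_closedBall (0 : Euc d) ρ).of_isClosed_subset (isClosed_tsupport _)
    ((tsupport_ballCutoff_subset_ball hρ n).trans Metric.ball_subset_closedBall)

/-- A polynomial cut off near the boundary of the ball. -/
def cutoffPoly (hρ : 0 < ρ) (hΩ : (Ω : Set (Euc d)) = Metric.ball 0 ρ) (n : ℕ)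
    (p : MvPolynomial (Fin d) ℝ) : 𝓓(Ω, ℝ) where
  toFun x := ballCutoff ρ n x * polyFun p x
  contDiff' := (contDiff_ballCutoff n).mul (contDiff_polyFun p)
  hasCompactSupport' := (hasCompactSupport_ballCutoff hρ n).mul_right
  tsupport_subset' := by
    rw [hΩ]
    exact (tsupport_mul_subset_left).trans (tsupport_ballCutoff_subset_ball hρ n)

theorem coe_cutoffPoly (hρ : 0 < ρ) (hΩ : (Ω : Set (Euc d)) = Metric.ball 0 ρ) (n : ℕ)
    (p : MvPolynomial (Fin d) ℝ) :
    ⇑(cutoffPoly hρ hΩ n p) = fun x => ballCutoff ρ n x * polyFun p x := rfl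

theorem tendsto_mul_ballPoly {x : Euc d} (hx : x ∈ Metric.ball (0 : Euc d) ρ) :
    Tendsto (fun n : ℕ => (n : ℝ) * polyFun (ballPoly d ρ) x) atTop atTop :=
  tendsto_natCast_atTop_atTop.atTop_mul_const (polyFun_ballPoly_pos hx)

theorem tendsto_ballCutoff {x : Euc d} (hx : x ∈ Metric.ball (0 : Euc d) ρ) :
    Tendsto (fun n => ballCutoff ρ n x) atTop (𝓝 1) := by
  refine tendsto_const_nhds.congr' ?_
  filter_upwards [(tendsto_mul_ballPoly hx).eventually_ge_atTop 2] with n hn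
  exact (step_of_two_le hn).symm

theorem norm_ballCutoff_le_one (n : ℕ) (x : Euc d) : ‖ballCutoff ρ n x‖ ≤ 1 := by
  rw [Real.norm_eq_abs, ballCutoff, abs_of_nonneg (step_nonneg _)]
  exact step_le_one _

/-- The derivative of the cutoff tends to zero pointwise in the open ball. It is not bounded
uniformly in `n`, but its product with `ρ² - |x|²` is (`exists_cutoffDeriv_mul_le`). -/
theorem tendsto_cutoffDeriv {x : Euc d} (hx : x ∈ Metric.ball (0 : Euc d) ρ) (c : ℝ) :
    Tendsto (fun n : ℕ => n * deriv step (n * polyFun (ballPoly d ρ) x) * c) atTop (𝓝 0) := by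
  refine tendsto_const_nhds.congr' ?_
  filter_upwards [(tendsto_mul_ballPoly hx).eventually_gt_atTop 2] with n hn
  rw [deriv_step_of_two_lt hn]
  simp

theorem exists_cutoffDeriv_mul_le (ρ : ℝ) : ∃ K, 0 ≤ K ∧ ∀ (n : ℕ),
    ∀ x ∈ Metric.ball (0 : Euc d) ρ, ∀ c : ℝ,
      ‖n * deriv step (n * polyFun (ballPoly d ρ) x) * (polyFun (ballPoly d ρ) x * c)‖ ≤
        K * ‖c‖ := by
  obtain ⟨K, hK0, hK⟩ := exists_mul_deriv_step_le
  refine ⟨K, hK0, fun n x hx c => ?_⟩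
  have h := hK (n * polyFun (ballPoly d ρ) x)
    (mul_nonneg (Nat.cast_nonneg _) (polyFun_ballPoly_pos hx).le)
  rw [show n * deriv step (n * polyFun (ballPoly d ρ) x) * (polyFun (ballPoly d ρ) x * c) =
    n * polyFun (ballPoly d ρ) x * deriv step (n * polyFun (ballPoly d ρ) x) * c by ring, norm_mul]
  exact mul_le_mul_of_nonneg_right h (norm_nonneg c)

theorem continuous_cutoffDeriv (n : ℕ) :
    Continuous fun x : Euc d => n * deriv step (n * polyFun (ballPoly d ρ) x) :=
  continuous_const.mul
    (continuous_deriv_step.comp (continuous_const.mul (continuous_polyFun _)))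

theorem isBounded_of_eq_ball (hΩ : (Ω : Set (Euc d)) = Metric.ball 0 ρ) :
    Bornology.IsBounded (Ω : Set (Euc d)) := hΩ ▸ Metric.isBounded_ball

/-- A polynomial multiple of `ρ² - |x|²` belongs to `H¹₀` of the ball of radius `ρ`. -/
theorem polyH1_mem_H10 (hρ : 0 < ρ) (hΩ : (Ω : Set (Euc d)) = Metric.ball 0 ρ)
    (q : MvPolynomial (Fin d) ℝ) :
    polyH1 (isBounded_of_eq_ball hΩ) (ballPoly d ρ * q) ∈ H10 Ω := by
  have hb := isBounded_of_eq_ball hΩ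
  let u := ballPoly d ρ * q
  have hmem : ∀ x ∈ (Ω : Set (Euc d)), x ∈ Metric.ball (0 : Euc d) ρ := fun x hx => hΩ ▸ hx
  have hlim : Tendsto (fun n => (testH10 (cutoffPoly hρ hΩ n u) : H1 Ω)) atTop
      (𝓝 (polyH1 hb u)) := by
    rw [tendsto_subtype_rng]
    refine ((WithLp.prod_continuous_toLp 2 _ _).tendsto _).comp (Tendsto.prodMk_nhds ?_
      (((PiLp.continuous_toLp 2 _).tendsto _).comp (tendsto_pi_nhds.2 fun i => ?_)))
    · obtain ⟨C, hC0, hC⟩ := exists_forall_norm_le_of_continuous hb (continuous_polyFun u)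
      refine tendsto_toLp_of_bounded hb (fun n => (cutoffPoly hρ hΩ n u).continuous)
        (continuous_polyFun u) (C := C) (fun n x hx => ?_) (fun x hx => ?_) _
          (memLp_of_continuous hb (continuous_polyFun u))
      · rw [coe_cutoffPoly, norm_mul]
        have := mul_le_mul (norm_ballCutoff_le_one (ρ := ρ) n x) (hC x hx) (norm_nonneg _)
          zero_le_one
        linarith
      · simpa [coe_cutoffPoly] using (tendsto_ballCutoff (hmem x hx)).mul_const (polyFun u x)
    · obtain ⟨C, hC0, hC⟩ := exists_forall_norm_le_of_continuous hb
        (continuous_polyFun (MvPolynomial.pderiv i u))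
      obtain ⟨C', hC0', hC'⟩ := exists_forall_norm_le_of_continuous hb
        (continuous_polyFun (q * MvPolynomial.pderiv i (ballPoly d ρ)))
      obtain ⟨K, hK0, hK⟩ := exists_cutoffDeriv_mul_le (d := d) ρ
      have hd : ∀ n x, partialDeriv i (cutoffPoly hρ hΩ n u) x =
          ballCutoff ρ n x * polyFun (MvPolynomial.pderiv i u) x +
          n * deriv step (n * polyFun (ballPoly d ρ) x) * (polyFun (ballPoly d ρ) x *
            polyFun (q * MvPolynomial.pderiv i (ballPoly d ρ)) x) := fun n x => by
        rw [coe_cutoffPoly, partialDeriv_mul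
          ((contDiff_ballCutoff n (k := 1)).differentiable (by simp) x)
          (differentiable_polyFun _ x), partialDeriv_ballCutoff, partialDeriv_polyFun,
          polyFun_mul, polyFun_mul]
        ring
      refine tendsto_toLp_of_bounded hb (fun n => ?_)
        (continuous_polyFun (MvPolynomial.pderiv i u)) (C := C + K * C') (fun n x hx => ?_)
        (fun x hx => ?_) _ (memLp_of_continuous hb (continuous_polyFun _))
      · exact ((cutoffPoly hρ hΩ n u).contDiff.continuous_fderiv (by simp)).clm_apply
          continuous_const
      · rw [hd]
        refine (norm_add_le _ _).trans (add_le_add ?_ ?_)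
        · rw [norm_mul]
          have := mul_le_mul (norm_ballCutoff_le_one (ρ := ρ) n x) (hC x hx) (norm_nonneg _)
            zero_le_one
          linarith
        · exact (hK n x (hmem x hx) _).trans (mul_le_mul_of_nonneg_left (hC' x hx) hK0)
      · simp only [hd]
        simpa using ((tendsto_ballCutoff (hmem x hx)).mul_const
          (polyFun (MvPolynomial.pderiv i u) x)).add (tendsto_cutoffDeriv (hmem x hx) _)
  exact (Submodule.isClosed_topologicalClosure (H1.testFunctions Ω)).mem_of_tendsto hlim
    (Eventually.of_forall fun n => (testH10 (cutoffPoly hρ hΩ n u)).2)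

/-- The divergence theorem on the ball, with the boundary integral written as a limit of integrals
over thin shells. -/
theorem tendsto_shell_integral (hρ : 0 < ρ) (hΩ : (Ω : Set (Euc d)) = Metric.ball 0 ρ)
    (G : Fin d → MvPolynomial (Fin d) ℝ) :
    Tendsto (fun n : ℕ => ∫ x in (Ω : Set (Euc d)), n * deriv step (n * polyFun (ballPoly d ρ) x) *
        polyFun (∑ i, MvPolynomial.pderiv i (ballPoly d ρ) * G i) x) atTop
      (𝓝 (-∫ x in (Ω : Set (Euc d)), polyFun (∑ i, MvPolynomial.pderiv i (G i)) x)) := by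
  have hb := isBounded_of_eq_ball hΩ
  have hmem : ∀ x ∈ (Ω : Set (Euc d)), x ∈ Metric.ball (0 : Euc d) ρ := fun x hx => hΩ ▸ hx
  have h1 : ∀ (n : ℕ) i, ∫ x in (Ω : Set (Euc d)), n * deriv step (n * polyFun (ballPoly d ρ) x) *
      polyFun (MvPolynomial.pderiv i (ballPoly d ρ) * G i) x =
      -∫ x in (Ω : Set (Euc d)), polyFun (MvPolynomial.pderiv i (G i)) x * ballCutoff ρ n x := by
    intro n i
    have h2 := setIntegral_mul_partialDeriv (Ω := Ω) (contDiff_polyFun (G i))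
      (cutoffPoly hρ hΩ n 1) i
    have h3 : ⇑(cutoffPoly hρ hΩ n 1) = ballCutoff ρ n := by
      rw [coe_cutoffPoly]
      ext x
      rw [show (1 : MvPolynomial (Fin d) ℝ) = MvPolynomial.C 1 by simp, polyFun_C, mul_one]
    rw [h3, partialDeriv_polyFun] at h2
    rw [← h2]
    refine integral_congr_ae (ae_of_all _ fun x => ?_)
    simp only [partialDeriv_ballCutoff, polyFun_mul]
    ring
  have h2 : ∀ n : ℕ, ∫ x in (Ω : Set (Euc d)), n * deriv step (n * polyFun (ballPoly d ρ) x) *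
      polyFun (∑ i, MvPolynomial.pderiv i (ballPoly d ρ) * G i) x =
      -∫ x in (Ω : Set (Euc d)), polyFun (∑ i, MvPolynomial.pderiv i (G i)) x *
        ballCutoff ρ n x := fun n => by
    simp only [polyFun_sum, Finset.mul_sum, Finset.sum_mul]
    rw [integral_finsetSum, integral_finsetSum, ← Finset.sum_neg_distrib]
    · exact Finset.sum_congr rfl fun i _ => h1 n i
    · exact fun i _ => integrableOn_of_continuous hb
        ((continuous_polyFun _).mul (contDiff_ballCutoff n (k := 0)).continuous)
    · exact fun i _ => integrableOn_of_continuous hb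
        ((continuous_cutoffDeriv n).mul (continuous_polyFun _))
  simp only [h2]
  obtain ⟨C, hC0, hC⟩ := exists_forall_norm_le_of_continuous hb
    (continuous_polyFun (∑ i, MvPolynomial.pderiv i (G i)))
  refine (tendsto_setIntegral_of_bounded hb (C := C) (fun n => (continuous_polyFun _).mul
    (contDiff_ballCutoff n (k := 0)).continuous) (fun n x hx => ?_) (fun x hx => ?_)).neg
  · rw [Pi.mul_apply, norm_mul]
    have := mul_le_mul (hC x hx) (norm_ballCutoff_le_one (ρ := ρ) n x) (norm_nonneg _) hC0
    linarith
  · simpa using (tendsto_ballCutoff (hmem x hx)).const_mul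
      (polyFun (∑ i, MvPolynomial.pderiv i (G i)) x)

/-- The a priori estimate `‖D²u‖ ≤ ‖Δu‖` on the ball, for polynomials `u` that vanish on the
sphere. The difference `‖Δu‖² - ‖D²u‖²` is the outward flux of `(Δu) ∇u - (D²u) ∇u` through the
sphere, which is nonnegative by convexity of the ball. -/
theorem integral_hessian_le (hd : 0 < d) (hρ : 0 < ρ)
    (hΩ : (Ω : Set (Euc d)) = Metric.ball 0 ρ) (q : MvPolynomial (Fin d) ℝ) :
    ∫ x in (Ω : Set (Euc d)), polyFun (∑ i, ∑ j,
        MvPolynomial.pderiv i (MvPolynomial.pderiv j (ballPoly d ρ * q)) *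
        MvPolynomial.pderiv i (MvPolynomial.pderiv j (ballPoly d ρ * q))) x ≤
      ∫ x in (Ω : Set (Euc d)),
        polyFun (polyLap (ballPoly d ρ * q) * polyLap (ballPoly d ρ * q)) x := by
  have hb := isBounded_of_eq_ball hΩ
  have hmem : ∀ x ∈ (Ω : Set (Euc d)), x ∈ Metric.ball (0 : Euc d) ρ := fun x hx => hΩ ▸ hx
  obtain ⟨P, hP⟩ := exists_normal_hessianField ρ q
  have h1 := tendsto_shell_integral hρ hΩ (hessianField (ballPoly d ρ * q))
  rw [div_hessianField, hP] at h1
  simp only [polyFun_sub] at h1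
  rw [integral_sub (integrableOn_of_continuous hb (continuous_polyFun _))
    (integrableOn_of_continuous hb (continuous_polyFun _)), neg_sub] at h1
  obtain ⟨C, hC0, hC⟩ := exists_forall_norm_le_of_continuous hb (continuous_polyFun P)
  obtain ⟨K, hK0, hK⟩ := exists_cutoffDeriv_mul_le (d := d) ρ
  have h2 : Tendsto (fun n : ℕ => ∫ x in (Ω : Set (Euc d)),
      n * deriv step (n * polyFun (ballPoly d ρ) x) * (polyFun (ballPoly d ρ) x * polyFun P x))
      atTop (𝓝 0) := by
    have h3 := tendsto_setIntegral_of_bounded hb (g := fun (n : ℕ) x =>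
        n * deriv step (n * polyFun (ballPoly d ρ) x) * (polyFun (ballPoly d ρ) x * polyFun P x))
      (g₀ := fun _ => 0) (C := K * C) (fun n => (continuous_cutoffDeriv n).mul
        ((continuous_polyFun _).mul (continuous_polyFun P)))
      (fun n x hx => (hK n x (hmem x hx) _).trans (mul_le_mul_of_nonneg_left (hC x hx) hK0))
      (fun x hx => tendsto_cutoffDeriv (hmem x hx) _)
    simpa using h3
  have h4 := le_of_tendsto_of_tendsto' h2 h1 fun n => by
    refine integral_mono (integrableOn_of_continuous hb ?_) (integrableOn_of_continuous hb ?_)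
      fun x => ?_
    · exact (continuous_cutoffDeriv n).mul ((continuous_polyFun _).mul (continuous_polyFun P))
    · exact (continuous_cutoffDeriv n).mul (continuous_polyFun _)
    · refine mul_le_mul_of_nonneg_left ?_ (mul_nonneg (Nat.cast_nonneg _) (deriv_step_nonneg _))
      rw [polyFun_add, polyFun_mul (ballPoly d ρ) P, le_add_iff_nonneg_left]
      have h5 : polyFun (8 * ((d : MvPolynomial (Fin d) ℝ) - 1) *
          (q * q * ∑ i, MvPolynomial.X i * MvPolynomial.X i)) x =
          8 * (d - 1) * (polyFun q x * polyFun q x * ∑ i, x i * x i) := by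
        simp [polyFun]
      rw [h5]
      have h6 : (1 : ℝ) ≤ d := by exact_mod_cast hd
      exact mul_nonneg (by linarith) (mul_nonneg (mul_self_nonneg _)
        (Finset.sum_nonneg fun i _ => mul_self_nonneg _))
  linarith

end BallEstimate

/-! ### H² regularity on a ball -/

section BallRegularity

variable {d : ℕ} {Ω : Opens (Euc d)} {ρ : ℝ}

/-- The function `(ρ² - |x|²) q` as an element of `H¹₀` of the ball of radius `ρ`. -/
def ballH10 (hρ : 0 < ρ) (hΩ : (Ω : Set (Euc d)) = Metric.ball 0 ρ)
    (q : MvPolynomial (Fin d) ℝ) : H10 Ω :=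
  ⟨polyH1 (isBounded_of_eq_ball hΩ) (ballPoly d ρ * q), polyH1_mem_H10 hρ hΩ q⟩

theorem toL2_ballH10 (hρ : 0 < ρ) (hΩ : (Ω : Set (Euc d)) = Metric.ball 0 ρ)
    (q : MvPolynomial (Fin d) ℝ) :
    H10.toL2 Ω (ballH10 hρ hΩ q) = polyL2 (isBounded_of_eq_ball hΩ) (ballPoly d ρ * q) := rfl

theorem grad_ballH10 (hρ : 0 < ρ) (hΩ : (Ω : Set (Euc d)) = Metric.ball 0 ρ)
    (q : MvPolynomial (Fin d) ℝ) (i : Fin d) :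
    H10.grad Ω (ballH10 hρ hΩ q) i =
      polyL2 (isBounded_of_eq_ball hΩ) (MvPolynomial.pderiv i (ballPoly d ρ * q)) := rfl

theorem laplacian_ballH10 (hρ : 0 < ρ) (hΩ : (Ω : Set (Euc d)) = Metric.ball 0 ρ)
    (q : MvPolynomial (Fin d) ℝ) :
    laplacian Ω (ballH10 hρ hΩ q) =
      L2.toHneg1 Ω (polyL2 (isBounded_of_eq_ball hΩ) (polyLap (ballPoly d ρ * q))) := by
  ext v
  rw [laplacian_apply, L2.toHneg1_apply]
  refine H10.induction_closed (P := fun v => -inner ℝ (H10.grad Ω (ballH10 hρ hΩ q))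
    (H10.grad Ω v) = inner ℝ (polyL2 (isBounded_of_eq_ball hΩ) (polyLap (ballPoly d ρ * q)))
    (H10.toL2 Ω v)) (isClosed_eq (by fun_prop) (by fun_prop)) (fun φ => ?_) v
  rw [PiLp.inner_apply, H10.toL2_testH10, polyLap_apply, map_sum, sum_inner,
    ← Finset.sum_neg_distrib]
  refine Finset.sum_congr rfl fun i _ => ?_
  have h := isWeakDeriv_iff_inner.1 (isWeakDeriv_polyL2 (isBounded_of_eq_ball hΩ)
    (MvPolynomial.pderiv i (ballPoly d ρ * q)) i) φ
  rw [H10.grad_testH10, grad_ballH10, h, neg_neg]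

theorem eq_zero_of_polyL2_eq_zero (hρ : 0 < ρ) (hΩ : (Ω : Set (Euc d)) = Metric.ball 0 ρ)
    {p : MvPolynomial (Fin d) ℝ} (hp : polyL2 (isBounded_of_eq_ball hΩ) p = 0) : p = 0 := by
  rw [polyL2_apply, Lp.eq_zero_iff_ae_eq_zero] at hp
  have h1 : polyFun p =ᵐ[volume.restrict (Ω : Set (Euc d))] fun _ => 0 :=
    (MemLp.coeFn_toLp _).symm.trans hp
  have h2 : EqOn (polyFun p) (fun _ => 0) (Ω : Set (Euc d)) :=
    Measure.eqOn_open_of_ae_eq h1 Ω.isOpen (continuous_polyFun p).continuousOn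
      continuousOn_const
  have h3 : {x : Fin d → ℝ | WithLp.toLp 2 x ∈ Metric.ball (0 : Euc d) ρ} ∈ 𝓝 (0 : Fin d → ℝ) := by
    refine (PiLp.continuous_toLp 2 _).continuousAt.preimage_mem_nhds ?_
    exact Metric.ball_mem_nhds _ hρ
  obtain ⟨ε, hε, hsub⟩ := Metric.mem_nhds_iff.1 h3
  refine MvPolynomial.funext_set (fun _ => Metric.ball 0 ε)
    (fun _ => infinite_of_mem_nhds (0 : ℝ) (Metric.ball_mem_nhds _ hε)) fun x hx => ?_
  have h4 : x ∈ Metric.ball (0 : Fin d → ℝ) ε := by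
    rw [mem_ball_zero_iff, pi_norm_lt_iff hε]
    exact fun i => mem_ball_zero_iff.1 (hx i trivial)
  have h5 := h2 (show WithLp.toLp 2 x ∈ (Ω : Set (Euc d)) from hΩ ▸ hsub h4)
  rw [map_zero]
  exact h5

/-- Every polynomial is the Laplacian of a polynomial multiple of `ρ² - |x|²`: the map
`q ↦ Δ((ρ² - |x|²) q)` does not raise the degree, and it is injective by uniqueness for the
Dirichlet problem, hence bijective on the finite-dimensional space of polynomials of degree at most
`m`. -/
theorem exists_polyLap_eq (hd : 0 < d) (hρ : 0 < ρ) (hΩ : (Ω : Set (Euc d)) = Metric.ball 0 ρ)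
    (p : MvPolynomial (Fin d) ℝ) : ∃ q, polyLap (ballPoly d ρ * q) = p := by
  have hb := isBounded_of_eq_ball hΩ
  have hinj : ∀ q, polyLap (ballPoly d ρ * q) = 0 → q = 0 := by
    intro q hq
    have h1 := laplacian_apply Ω (ballH10 hρ hΩ q) (ballH10 hρ hΩ q)
    rw [laplacian_ballH10, hq, map_zero, L2.toHneg1_apply, inner_zero_left] at h1
    have h2 : H10.grad Ω (ballH10 hρ hΩ q) = 0 := by
      rw [← inner_self_eq_zero (𝕜 := ℝ)]; linarith
    obtain ⟨C, -, hC⟩ := H10.exists_norm_toL2_le hd hb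
    have h3 := hC (ballH10 hρ hΩ q)
    rw [h2, norm_zero, mul_zero, toL2_ballH10] at h3
    have h4 := eq_zero_of_polyL2_eq_zero hρ hΩ (norm_le_zero_iff.1 h3)
    refine (mul_eq_zero.1 h4).resolve_left fun h5 => ?_
    have h6 := polyFun_ballPoly_pos (d := d) (Metric.mem_ball_self hρ)
    rw [h5] at h6
    simp [polyFun] at h6
  let m := p.totalDegree
  let T : MvPolynomial.restrictTotalDegree (Fin d) ℝ m →ₗ[ℝ]
      MvPolynomial.restrictTotalDegree (Fin d) ℝ m :=
    (polyLap ∘ₗ LinearMap.mulLeft ℝ (ballPoly d ρ)).restrict fun q hq => by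
      rw [MvPolynomial.mem_restrictTotalDegree] at hq ⊢
      refine totalDegree_polyLap_le ?_
      refine (MvPolynomial.totalDegree_mul _ _).trans ?_
      have := totalDegree_ballPoly_le (d := d) ρ
      omega
  have hT : Function.Injective T := by
    refine (injective_iff_map_eq_zero _).2 fun q hq => ?_
    exact Subtype.ext (hinj q.1 (congrArg Subtype.val hq))
  obtain ⟨q, hq⟩ := (LinearMap.injective_iff_surjective.1 hT)
    ⟨p, (MvPolynomial.mem_restrictTotalDegree _ _ _).2 le_rfl⟩
  exact ⟨q.1, congrArg Subtype.val hq⟩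

/-- The Laplacian `q ↦ Δ((ρ² - |x|²) q)` as a map into `L²`. -/
def ballLap (hΩ : (Ω : Set (Euc d)) = Metric.ball 0 ρ) : MvPolynomial (Fin d) ℝ →ₗ[ℝ] L2 Ω :=
  polyL2 (isBounded_of_eq_ball hΩ) ∘ₗ polyLap ∘ₗ LinearMap.mulLeft ℝ (ballPoly d ρ)

/-- The Hessian `q ↦ D²((ρ² - |x|²) q)` as a map into `L²`. -/
def ballHessian (hΩ : (Ω : Set (Euc d)) = Metric.ball 0 ρ) :
    MvPolynomial (Fin d) ℝ →ₗ[ℝ] PiLp 2 (fun _ : Fin d × Fin d => L2 Ω) :=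
  (WithLp.linearEquiv 2 ℝ (Fin d × Fin d → L2 Ω)).symm.toLinearMap ∘ₗ
    LinearMap.pi fun k => polyL2 (isBounded_of_eq_ball hΩ) ∘ₗ
      (MvPolynomial.pderiv k.2).toLinearMap ∘ₗ (MvPolynomial.pderiv k.1).toLinearMap ∘ₗ
        LinearMap.mulLeft ℝ (ballPoly d ρ)

theorem ballHessian_apply (hΩ : (Ω : Set (Euc d)) = Metric.ball 0 ρ)
    (q : MvPolynomial (Fin d) ℝ) (i j : Fin d) :
    ballHessian hΩ q (i, j) = polyL2 (isBounded_of_eq_ball hΩ)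
      (MvPolynomial.pderiv j (MvPolynomial.pderiv i (ballPoly d ρ * q))) := rfl

theorem ballLap_apply (hΩ : (Ω : Set (Euc d)) = Metric.ball 0 ρ) (q : MvPolynomial (Fin d) ℝ) :
    ballLap hΩ q = polyL2 (isBounded_of_eq_ball hΩ) (polyLap (ballPoly d ρ * q)) := rfl

theorem norm_ballHessian_le (hd : 0 < d) (hρ : 0 < ρ) (hΩ : (Ω : Set (Euc d)) = Metric.ball 0 ρ)
    (q : MvPolynomial (Fin d) ℝ) : ‖ballHessian hΩ q‖ ≤ 1 * ‖ballLap hΩ q‖ := by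
  have hb := isBounded_of_eq_ball hΩ
  rw [one_mul]
  refine le_of_sq_le_sq ?_ (norm_nonneg _)
  rw [ballLap_apply, norm_polyL2_sq, PiLp.norm_sq_eq_of_L2, Fintype.sum_prod_type]
  refine le_trans (le_of_eq ?_) (integral_hessian_le hd hρ hΩ q)
  simp only [ballHessian_apply, norm_polyL2_sq, polyFun_sum]
  rw [integral_finsetSum]
  · rw [Finset.sum_comm]
    refine Finset.sum_congr rfl fun i _ => ?_
    rw [integral_finsetSum]
    exact fun j _ => integrableOn_of_continuous hb (continuous_polyFun _)
  · exact fun i _ => integrable_finsetSum _ fun j _ =>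
      integrableOn_of_continuous hb (continuous_polyFun _)

theorem denseRange_ballLap (hd : 0 < d) (hρ : 0 < ρ)
    (hΩ : (Ω : Set (Euc d)) = Metric.ball 0 ρ) : DenseRange (ballLap hΩ) := by
  refine (denseRange_polyL2 (isBounded_of_eq_ball hΩ)).mono ?_
  rintro _ ⟨p, rfl⟩
  obtain ⟨q, hq⟩ := exists_polyLap_eq hd hρ hΩ p
  exact ⟨q, by rw [ballLap_apply, hq]⟩

/-- The bounded map that sends `g ∈ L²` to the Hessian of the solution of `Δu = g`, `u ∈ H¹₀`, on
the ball. -/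
def hessianMap (hΩ : (Ω : Set (Euc d)) = Metric.ball 0 ρ) :
    L2 Ω →L[ℝ] PiLp 2 (fun _ : Fin d × Fin d => L2 Ω) :=
  (ballHessian hΩ).extendOfNorm (ballLap hΩ)

/-- The energy estimate for `Δu = g`, with the constant `C` of the Poincaré inequality. -/
theorem norm_grad_le_of_laplacian_eq {C : ℝ} (hC0 : 0 ≤ C)
    (hC : ∀ u : H10 Ω, ‖H10.toL2 Ω u‖ ≤ C * ‖H10.grad Ω u‖) {u : H10 Ω} {g : L2 Ω}
    (h : laplacian Ω u = L2.toHneg1 Ω g) : ‖H10.grad Ω u‖ ≤ C * ‖g‖ := by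
  have h1 : -inner ℝ (H10.grad Ω u) (H10.grad Ω u) = inner ℝ g (H10.toL2 Ω u) := by
    rw [← laplacian_apply, h, L2.toHneg1_apply]
  rw [real_inner_self_eq_norm_sq] at h1
  have h2 := (abs_le.1 (abs_real_inner_le_norm g (H10.toL2 Ω u))).1
  have h3 := mul_le_mul_of_nonneg_left (hC u) (norm_nonneg g)
  have h4 : ‖H10.grad Ω u‖ * ‖H10.grad Ω u‖ ≤ ‖H10.grad Ω u‖ * (C * ‖g‖) := by nlinarith
  by_cases h0 : ‖H10.grad Ω u‖ = 0
  · rw [h0]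
    exact mul_nonneg hC0 (norm_nonneg g)
  · exact le_of_mul_le_mul_left h4 (lt_of_le_of_ne (norm_nonneg _) (Ne.symm h0))

/-- Regularity for the Dirichlet problem on the ball: if `Δuₙ → g` for polynomials `uₙ` that vanish
on the sphere, then `∇uₙ → ∇u` by the energy estimate, `D²uₙ` converges by the a priori estimate,
and weak derivatives are closed under these limits. -/
theorem isWeakDeriv_hessianMap (hd : 0 < d) (hρ : 0 < ρ)
    (hΩ : (Ω : Set (Euc d)) = Metric.ball 0 ρ) {u : H10 Ω} {g : L2 Ω}
    (h : laplacian Ω u = L2.toHneg1 Ω g) (i j : Fin d) :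
    IsWeakDeriv Ω j (H10.grad Ω u i) (hessianMap hΩ g (i, j)) := by
  obtain ⟨C, hC0, hC⟩ := H10.exists_norm_toL2_le hd (isBounded_of_eq_ball hΩ)
  obtain ⟨s, hs, hlim⟩ := mem_closure_iff_seq_limit.1 (denseRange_ballLap hd hρ hΩ g)
  choose q hq using hs
  have hlap : ∀ n, laplacian Ω (u - ballH10 hρ hΩ (q n)) = L2.toHneg1 Ω (g - s n) := fun n => by
    rw [sub_eq_add_neg, ← neg_one_smul ℝ (ballH10 hρ hΩ (q n)), laplacian_add, laplacian_smul, h,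
      laplacian_ballH10, sub_eq_add_neg, ← neg_one_smul ℝ (s n), L2.toHneg1_add, L2.toHneg1_smul,
      ← hq n, ballLap_apply]
  have hgrad : Tendsto (fun n => H10.grad Ω (ballH10 hρ hΩ (q n))) atTop (𝓝 (H10.grad Ω u)) := by
    rw [tendsto_iff_norm_sub_tendsto_zero]
    have h1 : Tendsto (fun n => C * ‖g - s n‖) atTop (𝓝 0) := by
      have := (tendsto_iff_norm_sub_tendsto_zero.1 hlim).const_mul C
      simpa [norm_sub_rev] using this
    refine squeeze_zero (fun n => norm_nonneg _) (fun n => ?_) h1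
    rw [norm_sub_rev, ← map_sub]
    exact norm_grad_le_of_laplacian_eq hC0 hC (hlap n)
  have hhess : Tendsto (fun n => ballHessian hΩ (q n)) atTop (𝓝 (hessianMap hΩ g)) := by
    refine (((hessianMap hΩ).continuous.tendsto g).comp hlim).congr fun n => ?_
    rw [Function.comp_apply, ← hq n]
    exact LinearMap.extendOfNorm_eq (denseRange_ballLap hd hρ hΩ)
      ⟨1, norm_ballHessian_le hd hρ hΩ⟩ (q n)
  rw [isWeakDeriv_iff_inner]
  intro φ
  have h1 : Tendsto (fun n => inner ℝ (H10.grad Ω (ballH10 hρ hΩ (q n)) i) (testDerivL2 j φ))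
      atTop (𝓝 (inner ℝ (H10.grad Ω u i) (testDerivL2 j φ))) :=
    (((PiLp.continuous_apply 2 _ i).tendsto _).comp hgrad).inner tendsto_const_nhds
  have h2 : Tendsto (fun n => -inner ℝ (ballHessian hΩ (q n) (i, j)) (testL2 φ))
      atTop (𝓝 (-inner ℝ (hessianMap hΩ g (i, j)) (testL2 φ))) :=
    ((((PiLp.continuous_apply 2 _ (i, j)).tendsto _).comp hhess).inner tendsto_const_nhds).neg
  refine tendsto_nhds_unique h1 (h2.congr fun n => ?_)
  rw [ballHessian_apply, grad_ballH10]
  exact (isWeakDeriv_iff_inner.1 (isWeakDeriv_polyL2 _ _ j) φ).symm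

/-- On a ball, `D(Δ)` embeds continuously in `H²`. -/
theorem exists_continuous_domLaplacian_toH2 (hd : 0 < d) (hρ : 0 < ρ)
    (hΩ : (Ω : Set (Euc d)) = Metric.ball 0 ρ) :
    ∃ Φ : DomLaplacian Ω → H2 Ω, Continuous Φ ∧
      ∀ p, H2.toL2 Ω (Φ p) = DomLaplacian.toL2 Ω p := by
  refine ⟨fun p => ⟨WithLp.toLp 2 (p.1.fst.1, hessianMap hΩ p.1.snd),
    fun i j => isWeakDeriv_hessianMap hd hρ hΩ p.2 i j⟩, ?_, fun p => rfl⟩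
  refine Continuous.subtype_mk ((WithLp.prod_continuous_toLp 2 _ _).comp ?_) _
  refine Continuous.prodMk ?_ ?_
  · exact continuous_subtype_val.comp ((WithLp.prod_continuous_ofLp 2 _ _).fst.comp
      continuous_subtype_val)
  · exact (hessianMap hΩ).continuous.comp ((WithLp.prod_continuous_ofLp 2 _ _).snd.comp
      continuous_subtype_val)

end BallRegularity

end DirichletWave

end

theorem proposition8p2 {d : ℕ} (hd : 0 < d)
    (Ω : TopologicalSpace.Opens (DirichletWave.Euc d))
    (hΩ : Bornology.IsBounded (Ω : Set (DirichletWave.Euc d)))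
    (f : ℝ → DirichletWave.L2 Ω) (hf : ContinuousOn f (Set.Ici 0)) :
    ∃ u : ℝ → DirichletWave.H10 Ω,
      -- existence and uniqueness of the weak solution
      DirichletWave.IsWeakSolution Ω f u ∧
      (∀ v : ℝ → DirichletWave.H10 Ω,
        DirichletWave.IsWeakSolution Ω f v → ∀ t : ℝ, 0 ≤ t → v t = u t) ∧
      -- the bound on the gradient
      (∀ t : ℝ, 0 ≤ t → ‖DirichletWave.H10.grad Ω (u t)‖ ≤ ∫ τ in (0 : ℝ)..t, ‖f τ‖) ∧
      -- `w(t) = ∫_0^t u(τ) dτ` is continuous from `[0, ∞)` to `D(Δ)`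
      (∃ w : ℝ → DirichletWave.DomLaplacian Ω, ContinuousOn w (Set.Ici 0) ∧
        ∀ t : ℝ, 0 ≤ t → DirichletWave.DomLaplacian.toL2 Ω (w t) =
          ∫ τ in (0 : ℝ)..t, DirichletWave.H10.toL2 Ω (u τ)) ∧
      -- if `Ω` is the ball `B_T = B(0, R + T)`, then `w` is continuous from `[0, ∞)` to `H²(B_T)`
      (∀ R T : ℝ, 0 < R → 0 ≤ T → (Ω : Set (DirichletWave.Euc d)) = Metric.ball 0 (R + T) →
        ∃ w : ℝ → DirichletWave.H2 Ω, ContinuousOn w (Set.Ici 0) ∧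
          ∀ t : ℝ, 0 ≤ t → DirichletWave.H2.toL2 Ω (w t) =
            ∫ τ in (0 : ℝ)..t, DirichletWave.H10.toL2 Ω (u τ)) := by
  obtain ⟨u, hu, huniq, hbound, w, hw, hwint⟩ := DirichletWave.exists_weakSolution hd hΩ hf
  refine ⟨u, hu, huniq, hbound, ⟨w, hw.continuousOn, hwint⟩, fun R T hR hT hball => ?_⟩
  obtain ⟨Φ, hΦ, hΦw⟩ := DirichletWave.exists_continuous_domLaplacian_toH2 hd
    (add_pos_of_pos_of_nonneg hR hT) hball
  exact ⟨fun t => Φ (w t), (hΦ.comp hw).continuousOn, fun t ht => (hΦw _).trans (hwint t ht)⟩
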